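/- Let $f\neq 0$ be a holomorphic cusp form of weight $\omega$ (a positive integer) for the full modular group $SL_2(\mathbb{Z})$ which is an eigenfunction of all Hecke operators $T_n$, $n\ge 1$. Write its Fourier expansion as $$f(z)=\sum_{n=1}^\infty \lambda_f(n)\,n^{\frac{\omega-1}{2}}e^{2\pi i n z},$$ let $L(f,s)$ be the entire function that continues $\sum_{n\ge1}\lambda_f(n)n^{-s}$ $(\Re(s)>1)$ analytically to $\mathbb{C}$, and let $\lambda_f^{-1}$ be the Dirichlet inverse of $\lambda_f$, i.e. the arithmetical function with $\sum_{d\mid n}\lambda_f(d)\lambda_f^{-1}(n/d)=1$ for $n=1$ and $=0$ for $n>1$. The Riemann hypothesis for $L(f,s)$ is the assertion that every non-trivial zero of $L(f,s)$, i.e. every zero other than the trivial zeros $s=-\frac{\omega-1}{2}-m$, $m=0,1,2,\dots$ (the poles of $\Gamma(s+\frac{\omega-1}{2})$), satisfies $\Re(s)=\frac12$. Let $k\ge\frac{\omega+1}{2}$ and $\ell>0$ be real numbers. Then the series $$P(x)=\sum_{n=1}^\infty\frac{\lambda_f^{-1}(n)}{n^k}\exp\left(-\frac{x}{n^\ell}\right)$$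 converges absolutely for every $x>0$, and the Riemann hypothesis for $L(f,s)$ is equivalent to the following: for every $\epsilon>0$, $$P(x)=O_{\epsilon,k,f,\ell}\left(x^{-\frac{k}{\ell}+\frac{1}{2\ell}+\epsilon}\right)\quad\text{as }x\to\infty.$$ -/

import Mathlib

open UpperHalfPlane MatrixGroups

noncomputable section

/-- The `n`-th Hecke operator of weight `ω` and level one:
`(T_n f)(z) = n ^ (ω - 1) * ∑_{a d = n} ∑_{0 ≤ b < d} d ^ (-ω) * f ((a z + b) / d)`.
For `n ≥ 1` and `a d = n` the point `(a z + b) / d` lies in the upper half plane, so that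
`ofComplex` is just the coercion back to it. -/
def heckeOperator (ω : ℤ) (n : ℕ) (f : ℍ → ℂ) (z : ℍ) : ℂ :=
  (n : ℂ) ^ (ω - 1) * ∑ p ∈ n.divisorsAntidiagonal, ∑ b ∈ Finset.range p.2,
    (p.2 : ℂ) ^ (-ω) * f (ofComplex (((p.1 : ℂ) * (z : ℂ) + (b : ℂ)) / (p.2 : ℂ)))

/-- A level one cusp form is a Hecke eigenform if it is nonzero and an eigenvector of all the
Hecke operators `T_n`, `n ≥ 1`. -/
def IsHeckeEigenform {ω : ℤ} (f : CuspForm 𝒮ℒ ω) : Prop :=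
  f ≠ 0 ∧ ∀ n : ℕ, 0 < n → ∃ c : ℂ, ∀ z : ℍ, heckeOperator ω n f z = c * f z

/-- The normalized Fourier coefficients `λ_f(n) = a_f(n) / n ^ ((ω - 1) / 2)`, where
`f(z) = ∑_{n ≥ 1} a_f(n) e ^ (2 π i n z)`. -/
def normalizedCoeff {ω : ℤ} (f : CuspForm 𝒮ℒ ω) : ArithmeticFunction ℂ where
  toFun n := if n = 0 then 0 else
    (qExpansion 1 f).coeff n / (n : ℂ) ^ (((ω : ℂ) - 1) / 2)
  map_zero' := by simp

/-- The Dirichlet inverse `λ_f⁻¹`, i.e. the inverse of `λ_f` in the ring of arithmetic functions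
(whose multiplication is Dirichlet convolution). It exists as soon as `λ_f(1) ≠ 0`. -/
def normalizedCoeffInv {ω : ℤ} (f : CuspForm 𝒮ℒ ω) : ArithmeticFunction ℂ :=
  Ring.inverse (normalizedCoeff f)

/-- The `L`-function `L(f, s)`, the entire continuation of `∑ λ_f(n) n ^ (-s)`. Mathlib's
`ModularForm.L` continues `∑ a_f(n) n ^ (-s)`, so the argument is shifted by `(ω - 1) / 2`. -/
def heckeLFunction {ω : ℤ} (hω : 0 < ω) (f : CuspForm 𝒮ℒ ω) (s : ℂ) : ℂ :=
  ModularForm.L hω f (s + ((ω : ℂ) - 1) / 2)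

/-- The Riemann hypothesis for `L(f, s)`: all zeros other than the trivial ones, which are located
at the poles `s = -(ω - 1) / 2 - m`, `m = 0, 1, 2, …`, of the gamma factor `Γ(s + (ω - 1) / 2)`,
have real part `1 / 2`. -/
def HeckeRiemannHypothesis {ω : ℤ} (hω : 0 < ω) (f : CuspForm 𝒮ℒ ω) : Prop :=
  ∀ s : ℂ, heckeLFunction hω f s = 0 →
    (¬ ∃ m : ℕ, s = -(((ω : ℂ) - 1) / 2) - (m : ℂ)) → s.re = 1 / 2

/-- `λ_f⁻¹` really is the Dirichlet inverse of `λ_f`. -/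
theorem normalizedCoeff_mul_inv {ω : ℤ} (f : CuspForm 𝒮ℒ ω) (h : normalizedCoeff f 1 ≠ 0) :
    normalizedCoeff f * normalizedCoeffInv f = 1 :=
  Ring.mul_inverse_cancel _
    (ArithmeticFunction.isUnit_iff_isUnit_apply_one.mpr (isUnit_iff_ne_zero.mpr h))

theorem differentiable_heckeLFunction {ω : ℤ} (hω : 0 < ω) (f : CuspForm 𝒮ℒ ω) :
    Differentiable ℂ (heckeLFunction hω f) :=
  (CuspForm.differentiable_L hω f).comp (differentiable_id.add_const _)

/-- `L(f, s)` is given by its Dirichlet series where the latter is easily seen to converge. -/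
theorem hasSum_heckeLFunction {ω : ℤ} (hω : 0 < ω) (f : CuspForm 𝒮ℒ ω) {s : ℂ}
    (hs : 3 / 2 < s.re) :
    HasSum (fun n : ℕ => normalizedCoeff f n / (n : ℂ) ^ s) (heckeLFunction hω f s) := by
  have hre : (s + ((ω : ℂ) - 1) / 2).re = s.re + ((ω : ℝ) - 1) / 2 := by
    simp [Complex.add_re]
  have hω' : (1 : ℝ) ≤ ω := by exact_mod_cast hω
  have key := CuspForm.hasSum_L (f := f) (s := s + ((ω : ℂ) - 1) / 2) hω (by
    rw [hre]; linarith)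
  rw [Subgroup.strictWidthInfty_SL2Z] at key
  simp only [Complex.ofReal_one, Complex.one_cpow, one_mul] at key
  change HasSum _ (ModularForm.L hω f (s + ((ω : ℂ) - 1) / 2))
  convert key using 2 with n
  rcases eq_or_ne n 0 with rfl | hn
  · have h0 : s + ((ω : ℂ) - 1) / 2 ≠ 0 := by
      intro h
      rw [h] at hre
      simp only [Complex.zero_re] at hre
      linarith
    simp [h0]
  · have hn' : (n : ℂ) ≠ 0 := Nat.cast_ne_zero.mpr hn
    simp only [normalizedCoeff, ArithmeticFunction.coe_mk, if_neg hn]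
    rw [Complex.cpow_add _ _ hn', div_div, mul_comm]

end

/-! Integrating term by term, the Mellin transform of `P` at `s` is `Γ(s) ∑ λ_f⁻¹(n) n ^ (ℓ s - k)`,
that is `Γ(s) / L(f, k - ℓ s)`, as long as `0 < re s` and `re (k - ℓ s) > 3 / 2`
(`mellin_rieszSeries_mul`). The criterion compares decay of `P` with holomorphy of this quotient up
to `re s = (k - 1 / 2) / ℓ`, the line that corresponds to `re w = 1 / 2` for `w = k - ℓ s`.

If `P` decays as stated, its Mellin transform is holomorphic in `0 < re s < (k - 1 / 2) / ℓ`, and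
the identity `mellin P s * L(f, k - ℓ s) = Γ(s)` continues to this strip. As `Γ` has no zeros,
neither has `L(f, w)` for `re w > 1 / 2`. By the functional equation this is the Riemann hypothesis.

Conversely, assume that there are no zeros to the right of `1 / 2`. Phragmén-Lindelöf gives
polynomial growth of `L`, Borel-Carathéodory turns it into polynomial growth of `1 / L`, and `Γ`
decays faster than any power. So the contour in the Mellin inversion formula can be moved to any `re
s = c' < (k - 1 / 2) / ℓ`, which yields `P(x) = O(x ^ (-c'))`.

Deligne's bound is not needed. Hecke's bound gives `λ_f(n) = O(n ^ (1 / 2))`, and the Euler product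
transfers it to `λ_f⁻¹`. A nonzero cusp form has weight at least 12, so `k ≥ 13 / 2`, well beyond
the abscissa `3 / 2` that these bounds provide. -/

/-! ### Fourier coefficients of eigenforms: Hecke relations and Hecke's bound. -/

theorem twelve_le_weight_of_cuspForm_ne_zero {ω : ℤ} {f : CuspForm 𝒮ℒ ω} (hf : f ≠ 0) :
    12 ≤ ω := by
  by_contra! h
  exact hf (rank_zero_iff_forall_zero.mp (CuspForm.rank_eq_zero_of_weight_lt_twelve h) f)

theorem hasSum_qExpansion_levelOne {ω : ℤ} (f : CuspForm 𝒮ℒ ω) {z : ℂ} (hz : 0 < z.im) :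
    HasSum (fun m : ℕ => (qExpansion 1 f).coeff m * Complex.exp (2 * Real.pi * Complex.I * z) ^ m)
      (f (ofComplex z)) := by
  have := ModularForm.hasSum_qExpansion f one_pos one_mem_strictPeriods_SL (ofComplex z)
  rw [ofComplex_apply_of_im_pos hz] at this ⊢
  simpa [Function.Periodic.qParam] using this

/-- Orthogonality of the `p`-th roots of unity: averaging over the translates `(z + b) / p` keeps
only the exponents divisible by `p`. -/
theorem sum_range_exp_pow (p m : ℕ) (hp : 1 < p) (z : ℂ) :
    ∑ b ∈ Finset.range p, Complex.exp (2 * Real.pi * Complex.I * ((z + b) / p)) ^ m =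
      if p ∣ m then (p : ℂ) * Complex.exp (2 * Real.pi * Complex.I * z) ^ (m / p) else 0 := by
  have hp0 : (p : ℂ) ≠ 0 := by exact_mod_cast (by omega : p ≠ 0)
  set ζ := Complex.exp (2 * Real.pi * Complex.I / p) with hζ
  have hprim : IsPrimitiveRoot ζ p := Complex.isPrimitiveRoot_exp p (by omega)
  have hterm (b : ℕ) : Complex.exp (2 * Real.pi * Complex.I * ((z + b) / p)) ^ m =
      Complex.exp (2 * Real.pi * Complex.I * (z / p)) ^ m * (ζ ^ m) ^ b := by
    rw [hζ, ← Complex.exp_nat_mul, ← Complex.exp_nat_mul, ← Complex.exp_nat_mul,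
      ← Complex.exp_nat_mul, ← Complex.exp_add]
    congr 1
    field_simp
  simp_rw [hterm, ← Finset.mul_sum]
  split_ifs with h
  · obtain ⟨n, rfl⟩ := h
    rw [Nat.mul_div_cancel_left _ (by omega), pow_mul ζ, hprim.pow_eq_one, pow_mul,
      ← Complex.exp_nat_mul _ p]
    rw [show (p : ℂ) * (2 * Real.pi * Complex.I * (z / p)) = 2 * Real.pi * Complex.I * z by
      field_simp]
    simp [mul_comm]
  · have hne : ζ ^ m ≠ 1 := fun H => h ((hprim.pow_eq_one_iff_dvd m).mp H)
    have : (ζ ^ m - 1) * ∑ b ∈ Finset.range p, (ζ ^ m) ^ b = 0 := by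
      rw [mul_comm, geom_sum_mul, ← pow_mul, mul_comm, pow_mul, hprim.pow_eq_one]
      simp
    rw [(mul_eq_zero.mp this).resolve_left (sub_ne_zero.mpr hne), mul_zero]

theorem heckeOperator_prime (ω : ℤ) {p : ℕ} (hp : p.Prime) (f : ℍ → ℂ) (z : ℍ) :
    heckeOperator ω p f z = (p : ℂ)⁻¹ * ∑ b ∈ Finset.range p, f (ofComplex (((z : ℂ) + b) / p)) +
      (p : ℂ) ^ (ω - 1) * f (ofComplex (p * (z : ℂ))) := by
  have hp0 : (p : ℂ) ≠ 0 := by exact_mod_cast hp.ne_zero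
  rw [heckeOperator, Nat.sum_divisorsAntidiagonal (fun a d => ∑ b ∈ Finset.range d,
    (d : ℂ) ^ (-ω) * f (ofComplex (((a : ℂ) * (z : ℂ) + (b : ℂ)) / (d : ℂ)))), hp.sum_divisors,
    Nat.div_self hp.pos, Nat.div_one]
  have : (p : ℂ) ^ (ω - 1) * (p : ℂ) ^ (-ω) = (p : ℂ)⁻¹ := by
    rw [← zpow_add₀ hp0, show ω - 1 + -ω = -1 by ring, zpow_neg_one]
  rw [← this]
  simp only [Finset.range_one, Finset.sum_singleton, Nat.cast_one, one_zpow, Nat.cast_zero,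
    add_zero, div_one, one_mul, ← Finset.mul_sum]
  ring

/-- The action of a prime Hecke operator on the Fourier coefficients of an eigenform. -/
theorem IsHeckeEigenform.exists_coeff_prime_mul {ω : ℤ} {f : CuspForm 𝒮ℒ ω}
    (hf : IsHeckeEigenform f) {p : ℕ} (hp : p.Prime) : ∃ c : ℂ, ∀ m : ℕ,
      (qExpansion 1 f).coeff (p * m) +
        (if p ∣ m then (p : ℂ) ^ (ω - 1) * (qExpansion 1 f).coeff (m / p) else 0) =
      c * (qExpansion 1 f).coeff m := by
  obtain ⟨c, hc⟩ := hf.2 p hp.pos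
  refine ⟨c, fun m => ?_⟩
  have hp0 : (p : ℂ) ≠ 0 := by exact_mod_cast hp.ne_zero
  have hinj : Function.Injective (fun m : ℕ => p * m) := mul_right_injective₀ hp.ne_zero
  set a : ℕ → ℂ := fun n => (qExpansion 1 f).coeff n with ha
  -- The eigenvalue equation is an identity of `q`-series, so uniqueness of the `q`-expansion of `c
  -- • f` gives the relation between coefficients.
  have key : ∀ z : ℍ, HasSum (fun m : ℕ =>
      (a (p * m) + (if p ∣ m then (p : ℂ) ^ (ω - 1) * a (m / p) else 0)) •
        Function.Periodic.qParam 1 (z : ℂ) ^ m) ((c • f : CuspForm 𝒮ℒ ω) z) := by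
    intro z
    have hq : Function.Periodic.qParam 1 (z : ℂ) = Complex.exp (2 * Real.pi * Complex.I * z) := by
      simp [Function.Periodic.qParam]
    rw [smul_apply, smul_eq_mul, ← hc z, heckeOperator_prime ω hp, hq]
    simp_rw [smul_eq_mul, add_mul]
    refine HasSum.add ?_ ?_
    · have h1 : HasSum (fun m : ℕ => ∑ b ∈ Finset.range p, a m *
          Complex.exp (2 * Real.pi * Complex.I * (((z : ℂ) + b) / p)) ^ m)
          (∑ b ∈ Finset.range p, f (ofComplex (((z : ℂ) + b) / p))) := by
        refine hasSum_sum fun b _ => hasSum_qExpansion_levelOne f ?_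
        rw [Complex.div_natCast_im]
        have := z.im_pos
        have hp' : (0 : ℝ) < p := by exact_mod_cast hp.pos
        simp only [Complex.add_im, coe_im, Complex.natCast_im, add_zero]
        positivity
      simp_rw [← Finset.mul_sum, sum_range_exp_pow p _ hp.one_lt] at h1
      rw [← hinj.hasSum_iff] at h1
      · refine HasSum.congr_fun (h1.mul_left (p : ℂ)⁻¹) fun m => ?_
        simp [Nat.mul_div_cancel_left _ hp.pos]
        field_simp
      · intro x hx
        have : ¬ p ∣ x := fun ⟨n, hn⟩ => hx ⟨n, hn.symm⟩
        simp [this]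
    · have h2 := (hasSum_qExpansion_levelOne f (z := p * z) (by
        have := z.im_pos
        have hp' : (0 : ℝ) < p := by exact_mod_cast hp.pos
        simp only [Complex.mul_im, Complex.natCast_re, coe_im, Complex.natCast_im, zero_mul,
          add_zero]
        positivity)).mul_left ((p : ℂ) ^ (ω - 1))
      rw [← hinj.hasSum_iff]
      · refine h2.congr_fun fun m => ?_
        simp only [Function.comp, dvd_mul_right, if_true, Nat.mul_div_cancel_left _ hp.pos]
        rw [pow_mul, ← Complex.exp_nat_mul _ p,
          show (p : ℂ) * (2 * Real.pi * Complex.I * z) = 2 * Real.pi * Complex.I * (p * z) by ring,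
          mul_assoc]
      · intro x hx
        have : ¬ p ∣ x := fun ⟨n, hn⟩ => hx ⟨n, hn.symm⟩
        simp [this]
  have := ModularFormClass.qExpansion_coeff_unique one_pos one_mem_strictPeriods_SL key m
  rw [this, FunLike.coe_smul,
    ModularForm.qExpansion_smul one_pos one_mem_strictPeriods_SL]
  simp

theorem normalizedCoeff_apply {ω : ℤ} (f : CuspForm 𝒮ℒ ω) {n : ℕ} (hn : n ≠ 0) :
    normalizedCoeff f n = (qExpansion 1 f).coeff n / (n : ℂ) ^ (((ω : ℂ) - 1) / 2) := by
  simp [normalizedCoeff, hn]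

/-- The normalization makes the relation weight-free: `p ^ (ω - 1)` is the square of `p ^ ((ω - 1) /
2)` and cancels. -/
theorem IsHeckeEigenform.exists_normalizedCoeff_prime_mul {ω : ℤ} {f : CuspForm 𝒮ℒ ω}
    (hf : IsHeckeEigenform f) {p : ℕ} (hp : p.Prime) : ∃ c : ℂ, ∀ m : ℕ,
      normalizedCoeff f (p * m) + (if p ∣ m then normalizedCoeff f (m / p) else 0) =
        c * normalizedCoeff f m := by
  obtain ⟨c, hc⟩ := hf.exists_coeff_prime_mul hp
  have hp0 : (p : ℂ) ≠ 0 := by exact_mod_cast hp.ne_zero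
  set κ : ℂ := ((ω : ℂ) - 1) / 2 with hκ
  have hpκ : (p : ℂ) ^ κ ≠ 0 := by simp [Complex.cpow_eq_zero_iff, hp0]
  refine ⟨c / (p : ℂ) ^ κ, fun m => ?_⟩
  rcases eq_or_ne m 0 with rfl | hm
  · simp
  have hm0 : (m : ℂ) ≠ 0 := by exact_mod_cast hm
  have hmκ : (m : ℂ) ^ κ ≠ 0 := by simp [Complex.cpow_eq_zero_iff, hm0]
  rw [normalizedCoeff_apply f hm, normalizedCoeff_apply f (mul_ne_zero hp.ne_zero hm), ← hκ,
    Nat.cast_mul, Complex.natCast_mul_natCast_cpow]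
  rw [div_mul_div_comm, ← hc m, add_div]
  congr 1
  split_ifs with h
  · obtain ⟨n, rfl⟩ := h
    have hn : n ≠ 0 := by rintro rfl; simp at hm
    have hn0 : (n : ℂ) ≠ 0 := by exact_mod_cast hn
    have hnκ : (n : ℂ) ^ κ ≠ 0 := by simp [Complex.cpow_eq_zero_iff, hn0]
    rw [Nat.mul_div_cancel_left _ hp.pos, normalizedCoeff_apply f hn, ← hκ, Nat.cast_mul,
      Complex.natCast_mul_natCast_cpow]
    have : (p : ℂ) ^ (ω - 1) = (p : ℂ) ^ κ * (p : ℂ) ^ κ := by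
      rw [← Complex.cpow_add _ _ hp0, ← Complex.cpow_intCast]
      congr 1
      rw [hκ]; push_cast; ring
    rw [this]
    field_simp
  · simp

/-- The relations at primes determine every coefficient from the first one, so `λ_f(1) = 0` would
force `f = 0`. -/
theorem IsHeckeEigenform.normalizedCoeff_one_ne_zero {ω : ℤ} {f : CuspForm 𝒮ℒ ω}
    (hf : IsHeckeEigenform f) : normalizedCoeff f 1 ≠ 0 := by
  intro h1
  have hall : ∀ n, normalizedCoeff f n = 0 := by
    intro n
    induction n using Nat.strong_induction_on with
    | _ n ih =>
    rcases Nat.lt_or_ge n 2 with hn | hn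
    · interval_cases n <;> simp [h1]
    · obtain ⟨p, hp, m, rfl⟩ := Nat.exists_prime_and_dvd (show n ≠ 1 by omega)
      obtain ⟨c, hc⟩ := hf.exists_normalizedCoeff_prime_mul hp
      have hm : 0 < m := Nat.pos_of_ne_zero (by rintro rfl; simp at hn)
      have hlt : m < p * m := by nlinarith [hp.two_le]
      have := hc m
      rw [ih m hlt, ih (m / p) ((Nat.div_le_self m p).trans_lt hlt)] at this
      simpa using this
  apply hf.1
  have hq : ∀ n, (qExpansion 1 f).coeff n = 0 := by
    intro n
    rcases eq_or_ne n 0 with rfl | hn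
    · exact CuspFormClass.qExpansion_coeff_zero f one_pos one_mem_strictPeriods_SL
    · have := hall n
      rw [normalizedCoeff_apply f hn, div_eq_zero_iff] at this
      have hn0 : (n : ℂ) ≠ 0 := by exact_mod_cast hn
      simpa [Complex.cpow_eq_zero_iff, hn0] using this
  ext z
  have := ModularForm.hasSum_qExpansion f one_pos one_mem_strictPeriods_SL z
  simp only [hq, zero_mul] at this
  simpa using this.unique hasSum_zero

theorem exists_norm_normalizedCoeff_le {ω : ℤ} (hω : 0 < ω) (f : CuspForm 𝒮ℒ ω) :
    ∃ C : ℝ, 0 ≤ C ∧ ∀ n : ℕ, ‖normalizedCoeff f n‖ ≤ C * (n : ℝ) ^ (1 / 2 : ℝ) := by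
  have h := CuspFormClass.qExpansion_isBigO f
  rw [Subgroup.strictWidthInfty_SL2Z, Asymptotics.isBigO_nat_atTop_iff (by
    intro n hn
    have hω' : (0 : ℝ) < ω := by exact_mod_cast hω
    rw [Real.rpow_eq_zero_iff_of_nonneg (by positivity)] at hn
    obtain rfl : n = 0 := by exact_mod_cast hn.1
    exact CuspFormClass.qExpansion_coeff_zero f one_pos one_mem_strictPeriods_SL)] at h
  obtain ⟨C, hC⟩ := h
  refine ⟨|C|, abs_nonneg C, fun n => ?_⟩
  rcases eq_or_ne n 0 with rfl | hn
  · simp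
  have hn0 : (0 : ℝ) < n := by exact_mod_cast Nat.pos_of_ne_zero hn
  rw [normalizedCoeff_apply f hn, norm_div, Complex.norm_natCast_cpow_of_pos (by omega),
    div_le_iff₀ (by positivity), mul_assoc, ← Real.rpow_add hn0]
  refine (hC n).trans ?_
  rw [Real.norm_of_nonneg (by positivity)]
  have : (1 / 2 + (((ω : ℂ) - 1) / 2).re : ℝ) = (ω : ℝ) / 2 := by simp; ring
  rw [this]
  gcongr
  exact le_abs_self C

/-! ### The Dirichlet inverse of a function satisfying the Hecke relations. -/

section HeckeMultiplicative

variable {f : ArithmeticFunction ℂ}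

/-- Hecke relations at primes, for a function normalized by `f 1 = 1`, imply multiplicativity. -/
theorem ArithmeticFunction.isMultiplicative_of_hecke (h1 : f 1 = 1)
    (hf : ∀ p : ℕ, p.Prime → ∀ m : ℕ,
      f (p * m) + (if p ∣ m then f (m / p) else 0) = f p * f m) : f.IsMultiplicative := by
  refine IsMultiplicative.iff_ne_zero.mpr ⟨h1, fun {m n} hm _ hmn => ?_⟩
  induction m using Nat.strong_induction_on with
  | _ m ih =>
  rcases eq_or_ne m 1 with rfl | hm1
  · simp [h1]
  obtain ⟨p, hp, l, rfl⟩ := Nat.exists_prime_and_dvd hm1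
  have hl : 0 < l := Nat.pos_of_ne_zero (by rintro rfl; simp at hm)
  have hlt : l < p * l := by nlinarith [hp.two_le]
  have hpn : p.Coprime n := hmn.coprime_mul_right
  have hln : l.Coprime n := hmn.coprime_mul_left
  have e1 := hf p hp (l * n)
  have e2 := hf p hp l
  rw [ih l hlt hl.ne' hln] at e1
  by_cases h : p ∣ l
  · obtain ⟨r, rfl⟩ := h
    have hr : 0 < r := Nat.pos_of_ne_zero (by rintro rfl; simp at hl)
    have hr' : r < p * (p * r) := lt_of_le_of_lt (Nat.le_mul_of_pos_left r hp.pos) hlt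
    have e3 := ih r hr' hr.ne' hln.coprime_mul_left
    rw [if_pos (Dvd.intro _ rfl), Nat.mul_div_cancel_left _ hp.pos] at e2
    rw [if_pos (dvd_mul_of_dvd_left (Dvd.intro _ rfl) n), mul_assoc p r n,
      Nat.mul_div_cancel_left _ hp.pos, e3, ← mul_assoc p r n, ← mul_assoc p (p * r) n] at e1
    linear_combination e1 - f n * e2
  · have h' : ¬ p ∣ l * n := by
      rw [hp.dvd_mul, not_or]
      exact ⟨h, fun H => hp.one_lt.ne' (Nat.eq_one_of_dvd_coprimes hpn dvd_rfl H)⟩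
    rw [if_neg h, add_zero] at e2
    rw [if_neg h', add_zero, ← mul_assoc] at e1
    rw [e1, e2]; ring

/-- The multiplicative function with values `-f p`, `1`, `0` at `p`, `p ^ 2`, `p ^ j`, `j ≥ 3`. -/
noncomputable def ArithmeticFunction.heckeInv (f : ArithmeticFunction ℂ) :
    ArithmeticFunction ℂ where
  toFun n := if n = 0 then 0 else
    n.factorization.prod fun p j => if j = 1 then -f p else if j = 2 then 1 else 0
  map_zero' := by simp

theorem ArithmeticFunction.isMultiplicative_heckeInv : f.heckeInv.IsMultiplicative := by
  refine IsMultiplicative.iff_ne_zero.mpr ⟨by simp [heckeInv], fun {m n} hm hn hmn => ?_⟩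
  simp only [heckeInv, coe_mk, hm, hn, mul_ne_zero hm hn, if_false]
  rw [Nat.factorization_mul_of_coprime hmn,
    Finsupp.prod_add_index_of_disjoint hmn.disjoint_primeFactors]

theorem ArithmeticFunction.heckeInv_prime_pow {p : ℕ} (hp : p.Prime) {j : ℕ} (hj : j ≠ 0) :
    f.heckeInv (p ^ j) = if j = 1 then -f p else if j = 2 then 1 else 0 := by
  simp only [heckeInv, coe_mk, pow_ne_zero j hp.ne_zero, if_false]
  rw [hp.factorization_pow, Finsupp.prod, Finsupp.support_single _ hj]
  simp

/-- The Euler factor at `p` is `1 / (1 - f(p) X + X ^ 2)`, so its inverse is a quadratic polynomial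
in `X = p ^ (-s)`. -/
theorem ArithmeticFunction.mul_heckeInv (h1 : f 1 = 1)
    (hf : ∀ p : ℕ, p.Prime → ∀ m : ℕ,
      f (p * m) + (if p ∣ m then f (m / p) else 0) = f p * f m) : f * f.heckeInv = 1 := by
  have hmul := isMultiplicative_of_hecke h1 hf
  have h01 : f.heckeInv 1 = 1 := isMultiplicative_heckeInv.map_one
  rw [IsMultiplicative.eq_iff_eq_on_prime_powers _ (hmul.mul isMultiplicative_heckeInv) _
    isMultiplicative_one]
  intro p i hp
  rcases eq_or_ne i 0 with rfl | hi
  · simp [h1, h01]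
  rw [one_apply_ne (by simp [hi, hp.ne_one]), mul_apply,
    Nat.sum_divisorsAntidiagonal' (fun a b => f a * f.heckeInv b), Nat.divisors_prime_pow hp,
    Finset.sum_map]
  simp only [Function.Embedding.coeFn_mk]
  have hdiv : ∀ j ∈ Finset.range (i + 1), f (p ^ i / p ^ j) * f.heckeInv (p ^ j) =
      f (p ^ (i - j)) * f.heckeInv (p ^ j) := fun j hj => by
    rw [Nat.pow_div (by simpa [Nat.lt_succ_iff] using hj) hp.pos]
  rw [Finset.sum_congr rfl hdiv]
  obtain ⟨i, rfl⟩ := Nat.exists_eq_succ_of_ne_zero hi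
  rcases i with _ | i
  · simp [Finset.sum_range_succ, h1, h01]
    have := heckeInv_prime_pow (f := f) hp (j := 1) one_ne_zero
    simp at this
    simp [this]
  · rw [Finset.sum_range_succ', Finset.sum_range_succ', Finset.sum_range_succ']
    have hz : ∀ j ∈ Finset.range i, f (p ^ (i + 1 + 1 - (j + 1 + 1 + 1))) *
        f.heckeInv (p ^ (j + 1 + 1 + 1)) = 0 := fun j _ => by
      rw [heckeInv_prime_pow hp (by omega), if_neg (by omega), if_neg (by omega), mul_zero]
    rw [Finset.sum_eq_zero hz, heckeInv_prime_pow hp (by omega), heckeInv_prime_pow hp (by omega)]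
    have e := hf p hp (p ^ (i + 1))
    rw [if_pos (dvd_pow_self p (by omega)), ← pow_succ', pow_succ p i,
      Nat.mul_div_cancel _ hp.pos, ← pow_succ] at e
    simp only [Nat.succ_eq_add_one, zero_add, Nat.add_sub_cancel, pow_zero,
      Nat.sub_zero, h01]
    norm_num
    rw [show i + 1 + 1 - 2 = i by omega]
    linear_combination e

/-- Bounding each prime factor by `C p ^ (1 / 2)` would cost one `C` per prime. Recombining the
values `f(p)` into a single `f(a)` by multiplicativity costs only one. -/
theorem ArithmeticFunction.exists_norm_heckeInv_le (h1 : f 1 = 1) (hmul : f.IsMultiplicative)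
    (n : ℕ) (hn : 0 < n) : ∃ a : ℕ, 0 < a ∧ a ∣ n ∧ ‖f.heckeInv n‖ ≤ ‖f a‖ := by
  induction n using Nat.recOnPosPrimePosCoprime with
  | prime_pow p j hp hj =>
    rw [heckeInv_prime_pow hp hj.ne']
    split_ifs with h h'
    · exact ⟨p, hp.pos, dvd_pow_self p hj.ne', by simp⟩
    · exact ⟨1, one_pos, one_dvd _, by simp [h1]⟩
    · exact ⟨1, one_pos, one_dvd _, by simp⟩
  | zero => exact absurd hn (lt_irrefl 0)
  | one => exact ⟨1, one_pos, dvd_rfl, by simp [h1, isMultiplicative_heckeInv.map_one]⟩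
  | coprime a b ha hb hab iha ihb =>
    obtain ⟨a', ha', had, hale⟩ := iha (by omega)
    obtain ⟨b', hb', hbd, hble⟩ := ihb (by omega)
    refine ⟨a' * b', by positivity, mul_dvd_mul had hbd, ?_⟩
    rw [isMultiplicative_heckeInv.map_mul_of_coprime hab,
      hmul.map_mul_of_coprime (hab.of_dvd had hbd), norm_mul, norm_mul]
    gcongr

end HeckeMultiplicative

theorem IsHeckeEigenform.exists_norm_normalizedCoeffInv_le {ω : ℤ} (hω : 0 < ω)
    {f : CuspForm 𝒮ℒ ω} (hf : IsHeckeEigenform f) :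
    ∃ C : ℝ, 0 ≤ C ∧ ∀ n : ℕ, ‖normalizedCoeffInv f n‖ ≤ C * (n : ℝ) ^ (1 / 2 : ℝ) := by
  set u := normalizedCoeff f 1 with hu
  have hu0 : u ≠ 0 := hf.normalizedCoeff_one_ne_zero
  -- The eigenform need not have `λ_f(1) = 1`, whereas multiplicativity needs it. Rescaling by `u⁻¹`
  -- is undone in `hinv`.
  set g : ArithmeticFunction ℂ := u⁻¹ • normalizedCoeff f with hg
  have hgv : ∀ n, g n = u⁻¹ * normalizedCoeff f n := fun n => by simp [hg]
  have hg1 : g 1 = 1 := by rw [hgv, ← hu, inv_mul_cancel₀ hu0]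
  have hrel : ∀ p : ℕ, p.Prime → ∀ m : ℕ,
      g (p * m) + (if p ∣ m then g (m / p) else 0) = g p * g m := by
    intro p hp m
    obtain ⟨c, hc⟩ := hf.exists_normalizedCoeff_prime_mul hp
    have hp1 : normalizedCoeff f p = c * u := by
      have := hc 1
      rwa [if_neg (by simpa using hp.ne_one), add_zero, mul_one] at this
    have := hc m
    simp only [hgv]
    rw [hp1, show u⁻¹ * (c * u) = c by field_simp]
    split_ifs at this ⊢
    · linear_combination u⁻¹ * this
    · linear_combination u⁻¹ * this
  have hinv : normalizedCoeffInv f = u⁻¹ • g.heckeInv := by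
    have e1 : normalizedCoeff f * (u⁻¹ • g.heckeInv) = 1 := by
      rw [mul_smul_comm, ← smul_mul_assoc]
      exact ArithmeticFunction.mul_heckeInv hg1 hrel
    have e2 := normalizedCoeff_mul_inv f hu0
    calc normalizedCoeffInv f = normalizedCoeffInv f * (normalizedCoeff f * (u⁻¹ • g.heckeInv)) := by
          rw [e1, mul_one]
      _ = (normalizedCoeff f * normalizedCoeffInv f) * (u⁻¹ • g.heckeInv) := by ring
      _ = _ := by rw [e2, one_mul]
  obtain ⟨C, hC0, hC⟩ := exists_norm_normalizedCoeff_le hω f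
  refine ⟨‖u⁻¹‖ * (‖u⁻¹‖ * C), by positivity, fun n => ?_⟩
  rcases Nat.eq_zero_or_pos n with rfl | hn
  · simp
  obtain ⟨a, ha, had, hle⟩ := ArithmeticFunction.exists_norm_heckeInv_le hg1
    (ArithmeticFunction.isMultiplicative_of_hecke hg1 hrel) n hn
  have : ‖normalizedCoeffInv f n‖ = ‖u⁻¹‖ * ‖g.heckeInv n‖ := by rw [hinv]; simp
  rw [this, mul_assoc, mul_assoc]
  gcongr
  refine hle.trans ?_
  rw [hgv, norm_mul]
  gcongr
  refine (hC a).trans ?_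
  gcongr
  exact Nat.le_of_dvd hn had

/-! ### Bounds for the gamma function in vertical strips. -/

theorem Complex.norm_Gamma_le_Gamma_re {s : ℂ} (hs : 0 < s.re) :
    ‖Complex.Gamma s‖ ≤ Real.Gamma s.re := by
  rw [Complex.Gamma_eq_integral hs, Real.Gamma_eq_integral hs, Complex.GammaIntegral]
  refine (MeasureTheory.norm_integral_le_integral_norm _).trans (le_of_eq ?_)
  refine MeasureTheory.setIntegral_congr_fun measurableSet_Ioi fun x hx => ?_
  have hx' : (0 : ℝ) < x := hx
  simp only [norm_mul, Complex.norm_real, Real.norm_eq_abs, abs_of_pos (Real.exp_pos _),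
    Complex.norm_cpow_eq_rpow_re_of_pos hx', Complex.sub_re, Complex.one_re]

/-- In the right half-plane `Γ` is dominated by its values on the real axis. Further left, `Γ(s) =
Γ(s + 1) / s` with `‖s‖ ≥ 1`, by induction on how far left the strip reaches. -/
theorem Complex.exists_norm_Gamma_le (a b : ℝ) :
    ∃ C : ℝ, 0 ≤ C ∧ ∀ s : ℂ, a ≤ s.re → s.re ≤ b → 1 ≤ |s.im| → ‖Complex.Gamma s‖ ≤ C := by
  obtain ⟨m, hm⟩ := exists_nat_gt (-a)
  induction m generalizing a b with
  | zero =>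
    have ha : 0 < a := by simpa using hm
    have hc : ContinuousOn Real.Gamma (Set.Icc a b) := fun x hx =>
      (Real.differentiableAt_Gamma fun n => by
        have : (0 : ℝ) ≤ n := n.cast_nonneg
        linarith [hx.1]).continuousAt.continuousWithinAt
    obtain ⟨C, hC⟩ := isCompact_Icc.exists_bound_of_continuousOn hc
    refine ⟨|C|, abs_nonneg C, fun s h1 h2 _ => ?_⟩
    exact (norm_Gamma_le_Gamma_re (ha.trans_le h1)).trans
      ((le_abs_self _).trans ((hC s.re ⟨h1, h2⟩).trans (le_abs_self C)))
  | succ m ih =>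
    obtain ⟨C, hC0, hC⟩ := ih (a + 1) (b + 1) (by push_cast at hm; linarith)
    refine ⟨C, hC0, fun s h1 h2 h3 => ?_⟩
    have hs : s ≠ 0 := by
      rintro rfl
      norm_num at h3
    have h4 : 1 ≤ ‖s‖ := h3.trans (Complex.abs_im_le_norm s)
    have := hC (s + 1) (by simpa using h1) (by simpa using h2) (by simpa using h3)
    rw [Complex.Gamma_add_one s hs, norm_mul] at this
    exact (le_mul_of_one_le_left (norm_nonneg _) h4).trans this

/-- The gamma function decays faster than any power on vertical strips. -/
theorem Complex.exists_norm_Gamma_mul_pow_le (m : ℕ) (a b : ℝ) :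
    ∃ C : ℝ, 0 ≤ C ∧ ∀ s : ℂ, a ≤ s.re → s.re ≤ b → 1 ≤ |s.im| →
      ‖Complex.Gamma s‖ * |s.im| ^ m ≤ C := by
  induction m generalizing a b with
  | zero => simpa using exists_norm_Gamma_le a b
  | succ m ih =>
    obtain ⟨C, hC0, hC⟩ := ih (a + 1) (b + 1)
    refine ⟨C, hC0, fun s h1 h2 h3 => ?_⟩
    have hs : s ≠ 0 := by
      rintro rfl
      norm_num at h3
    have := hC (s + 1) (by simpa using h1) (by simpa using h2) (by simpa using h3)
    -- Each shift `s ↦ s + 1` gains a factor `‖s‖ ≥ |im s|`.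
    rw [Complex.Gamma_add_one s hs, norm_mul] at this
    refine le_trans ?_ this
    have e : (s + 1).im = s.im := by simp
    rw [e, pow_succ, mul_comm ‖s‖, mul_assoc, mul_comm (|s.im| ^ m)]
    gcongr
    exact Complex.abs_im_le_norm s

theorem Complex.norm_sin_le_exp (z : ℂ) : ‖Complex.sin z‖ ≤ Real.exp |z.im| := by
  have h1 : ‖Complex.exp (-z * Complex.I)‖ ≤ Real.exp |z.im| := by
    rw [Complex.norm_exp]; gcongr; simpa using le_abs_self z.im
  have h2 : ‖Complex.exp (z * Complex.I)‖ ≤ Real.exp |z.im| := by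
    rw [Complex.norm_exp]; gcongr; simpa using neg_le_abs z.im
  rw [Complex.sin, norm_div, norm_mul, Complex.norm_I, mul_one, Complex.norm_ofNat]
  linarith [norm_sub_le (Complex.exp (-z * Complex.I)) (Complex.exp (z * Complex.I))]

/-- By the reflection formula `1 / Γ(s) = Γ(1 - s) sin(π s) / π`. This crude bound serves only as
the a priori growth condition in Phragmén-Lindelöf. -/
theorem Complex.exists_norm_Gamma_inv_le (a b : ℝ) :
    ∃ C : ℝ, 0 ≤ C ∧ ∀ s : ℂ, a ≤ s.re → s.re ≤ b → 1 ≤ |s.im| →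
      ‖(Complex.Gamma s)⁻¹‖ ≤ C * Real.exp (Real.pi * |s.im|) := by
  obtain ⟨C, hC0, hC⟩ := exists_norm_Gamma_le (1 - b) (1 - a)
  refine ⟨C, hC0, fun s h1 h2 h3 => ?_⟩
  have hsin : Complex.sin (Real.pi * s) ≠ 0 := by
    rw [Complex.sin_ne_zero_iff]
    intro k hk
    have hk' : s = (k : ℂ) := by
      have hpi : (Real.pi : ℂ) ≠ 0 := by exact_mod_cast Real.pi_ne_zero
      exact mul_left_cancel₀ hpi (hk.trans (mul_comm _ _))
    rw [hk'] at h3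
    norm_num at h3
  have hrefl := Complex.Gamma_mul_Gamma_one_sub s
  have hpi : (Real.pi : ℂ) ≠ 0 := by exact_mod_cast Real.pi_ne_zero
  have hΓ : Complex.Gamma s ≠ 0 := by
    intro h
    rw [h, zero_mul] at hrefl
    exact (div_ne_zero hpi hsin) hrefl.symm
  have e : (Complex.Gamma s)⁻¹ = Complex.Gamma (1 - s) * (Complex.sin (Real.pi * s) / Real.pi) := by
    rw [eq_div_iff hsin] at hrefl
    rw [mul_div_assoc', eq_div_iff hpi, inv_mul_eq_iff_eq_mul₀ hΓ]
    linear_combination -hrefl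
  rw [e, norm_mul, norm_div]
  have h4 := hC (1 - s) (by simp; linarith) (by simp; linarith) (by simpa using h3)
  have h5 : ‖Complex.sin (Real.pi * s)‖ ≤ Real.exp (Real.pi * |s.im|) := by
    have := norm_sin_le_exp (Real.pi * s)
    simpa [abs_mul, abs_of_pos Real.pi_pos] using this
  have h6 : ‖Complex.sin (Real.pi * s)‖ / ‖(Real.pi : ℂ)‖ ≤ Real.exp (Real.pi * |s.im|) := by
    rw [Complex.norm_real, Real.norm_of_nonneg Real.pi_pos.le]
    refine (div_le_self (norm_nonneg _) ?_).trans h5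
    linarith [Real.pi_gt_three]
  gcongr

/-! ### Nonvanishing holomorphic functions on a disc. -/

/-- A nonvanishing holomorphic function on a disc has a holomorphic logarithm. -/
theorem DifferentiableOn.exists_eq_mul_exp {F : ℂ → ℂ} {c : ℂ} {r : ℝ} (hr : 0 < r)
    (hF : DifferentiableOn ℂ F (Metric.ball c r)) (h0 : ∀ z ∈ Metric.ball c r, F z ≠ 0) :
    ∃ g : ℂ → ℂ, DifferentiableOn ℂ g (Metric.ball c r) ∧ g c = 0 ∧
      ∀ z ∈ Metric.ball c r, F z = F c * Complex.exp (g z) := by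
  have hd : DifferentiableOn ℂ (_root_.deriv F) (Metric.ball c r) := hF.deriv Metric.isOpen_ball
  obtain ⟨g, hg⟩ := (hd.div hF h0).isExactOn_ball
  have hc : c ∈ Metric.ball c r := Metric.mem_ball_self hr
  refine ⟨fun z => g z - g c, fun z hz =>
    ((hg z hz).differentiableAt.sub_const _).differentiableWithinAt, sub_self _, fun z hz => ?_⟩
  have hconst : ∀ w ∈ Metric.ball c r, HasDerivAt (fun w => F w * Complex.exp (-g w)) 0 w := by
    intro w hw
    have h1 := (hF.differentiableAt (Metric.isOpen_ball.mem_nhds hw)).hasDerivAt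
    have h2 := h1.mul (hg w hw).neg.cexp
    refine h2.congr_deriv ?_
    have := h0 w hw
    simp only [Pi.div_apply]
    field_simp
    ring
  have heq : F z * Complex.exp (-g z) = F c * Complex.exp (-g c) :=
    Metric.isOpen_ball.is_const_of_deriv_eq_zero (convex_ball c r).isPreconnected
      (fun w hw => (hconst w hw).differentiableAt.differentiableWithinAt)
      (fun w hw => (hconst w hw).deriv) hz hc
  change F z = F c * Complex.exp (g z - g c)
  rw [sub_eq_neg_add, Complex.exp_add, ← mul_assoc, ← heq, mul_assoc, ← Complex.exp_add]
  simp

/-- A lower bound for a nonvanishing holomorphic function, by the Borel-Carathéodory theorem. -/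
theorem norm_inv_le_of_norm_le_on_ball {F : ℂ → ℂ} {c z : ℂ} {R r M : ℝ} (hr : r < R) (hR : 0 < R)
    (hM : 0 < M) (hF : DifferentiableOn ℂ F (Metric.ball c R))
    (h0 : ∀ w ∈ Metric.ball c R, F w ≠ 0)
    (hle : ∀ w ∈ Metric.ball c R, ‖F w‖ ≤ ‖F c‖ * Real.exp M) (hz : ‖z - c‖ ≤ r) :
    ‖(F z)⁻¹‖ ≤ ‖(F c)⁻¹‖ * Real.exp (2 * M * R / (R - r)) := by
  obtain ⟨g, hg, hgc, hFg⟩ := hF.exists_eq_mul_exp hR h0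
  have hmem : ∀ w ∈ Metric.ball (0 : ℂ) R, w + c ∈ Metric.ball c R := fun w hw => by
    simpa [dist_eq_norm] using hw
  have hzR : z - c ∈ Metric.ball (0 : ℂ) R := by simpa using hz.trans_lt hr
  have hc0 : 0 < ‖F c‖ := norm_pos_iff.mpr (h0 c (Metric.mem_ball_self hR))
  -- For a logarithm `g` of `F / F c`, the hypothesis `hle` says `re g ≤ M`. Borel-Carathéodory
  -- converts this into a bound for `‖g‖`, hence for `re (-g)`.
  have hbc := Complex.borelCaratheodory_zero (f := fun w => g (w + c)) (z := z - c) hM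
    (hg.comp (by fun_prop) hmem) (fun w hw => by
      have h1 := hle _ (hmem w hw)
      rw [hFg _ (hmem w hw), norm_mul, Complex.norm_exp] at h1
      exact Real.exp_le_exp.mp (le_of_mul_le_mul_left h1 hc0)) hR hzR (by simpa using hgc)
  rw [sub_add_cancel] at hbc
  have hbc' : ‖g z‖ ≤ 2 * M * R / (R - r) := by
    refine hbc.trans ?_
    have : ‖z - c‖ < R := hz.trans_lt hr
    gcongr
  have hzb : z ∈ Metric.ball c R := by simpa using hmem _ hzR
  rw [hFg z hzb, mul_inv, norm_mul, ← Complex.exp_neg, Complex.norm_exp]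
  gcongr
  refine le_trans ?_ hbc'
  rw [Complex.neg_re]
  exact (neg_le_abs _).trans (Complex.abs_re_le_norm _)

/-! ### Analytic properties of `L(f, s)` and of its reciprocal. -/

section HeckeLFunction

variable {ω : ℤ} (hω : 0 < ω) (f : CuspForm 𝒮ℒ ω)

/-- Invariance of `f` under `S` makes the functional equation pair self-dual. -/
theorem CuspForm.completedL_functional_equation (s : ℂ) :
    ModularForm.Λ hω f (ω - s) = Complex.I ^ ω * ModularForm.Λ hω f s := by
  have h := (ModularForm.weakFEPair hω f).functional_equation s
  have hs := (CuspForm.isStrongFEPair hω f)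
  have hg : (ModularForm.weakFEPair hω f).g = (ModularForm.weakFEPair hω f).f := by
    ext t
    simp only [ModularForm.weakFEPair_g, ModularForm.weakFEPair_f]
    exact congr_fun (SlashInvariantFormClass.slash_action_eq f _ ⟨ModularGroup.S, rfl⟩) _
  rw [hs.symm_Λ_eq, hg, ← hs.Λ_eq] at h
  simpa [ModularForm.Λ] using h

/-- `Λ` is an absolutely convergent Mellin integral, and `t ^ (σ - 1) ≤ t ^ (a - 1) + t ^ (b - 1)`
for `a ≤ σ ≤ b`. -/
theorem CuspForm.exists_norm_completedL_le (a b : ℝ) :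
    ∃ C : ℝ, 0 ≤ C ∧ ∀ s : ℂ, a ≤ s.re → s.re ≤ b → ‖ModularForm.Λ hω f s‖ ≤ C := by
  have hs := (CuspForm.isStrongFEPair hω f)
  have hint (σ : ℝ) : MeasureTheory.IntegrableOn
      (fun t : ℝ => t ^ (σ - 1) * ‖f (ofComplex (Complex.I * t))‖) (Set.Ioi 0) := by
    have h := (hs.hasMellin (σ : ℂ)).1.norm
    refine MeasureTheory.IntegrableOn.congr_fun h (fun t ht => ?_) measurableSet_Ioi
    rw [norm_smul, Complex.norm_cpow_eq_rpow_re_of_pos ht]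
    simp
  refine ⟨∫ t in Set.Ioi (0 : ℝ), (t ^ (a - 1) * ‖f (ofComplex (Complex.I * t))‖ +
    t ^ (b - 1) * ‖f (ofComplex (Complex.I * t))‖), ?_, fun s h1 h2 => ?_⟩
  · refine MeasureTheory.setIntegral_nonneg measurableSet_Ioi fun t ht => ?_
    have ht' : (0 : ℝ) < t := ht
    positivity
  · rw [CuspForm.Λ_eq_mellin, mellin]
    refine (MeasureTheory.norm_integral_le_of_norm_le ((hint a).add (hint b)) ?_)
    refine (MeasureTheory.ae_restrict_iff' measurableSet_Ioi).mpr (.of_forall fun t ht => ?_)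
    have ht' : (0 : ℝ) < t := ht
    rw [norm_smul, Complex.norm_cpow_eq_rpow_re_of_pos ht, ← add_mul]
    gcongr
    rw [Complex.sub_re, Complex.one_re]
    rcases le_total 1 t with h | h
    · have := Real.rpow_le_rpow_of_exponent_le h (sub_le_sub_right h2 1)
      have := Real.rpow_nonneg ht'.le (a - 1)
      linarith
    · have := Real.rpow_le_rpow_of_exponent_ge ht' h (sub_le_sub_right h1 1)
      have := Real.rpow_nonneg ht'.le (b - 1)
      linarith

theorem heckeLFunction_eq (s : ℂ) : heckeLFunction hω f s =
    ModularForm.Λ hω f (s + ((ω : ℂ) - 1) / 2) *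
      ((2 * Real.pi : ℂ) ^ (s + ((ω : ℂ) - 1) / 2) *
        (Complex.Gamma (s + ((ω : ℂ) - 1) / 2))⁻¹) := by
  rw [heckeLFunction, ModularForm.L, Complex.Gammaℂ, Complex.cpow_neg]
  congr 1
  field_simp

variable {f}

theorem norm_div_natCast_cpow (a : ℕ → ℂ) (h0 : a 0 = 0) (s : ℂ) (n : ℕ) :
    ‖a n / (n : ℂ) ^ s‖ = ‖a n‖ / (n : ℝ) ^ s.re := by
  rcases Nat.eq_zero_or_pos n with rfl | hn
  · simp [h0]
  · rw [norm_div, Complex.norm_natCast_cpow_of_pos hn]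

theorem summable_norm_div_rpow {a : ℕ → ℂ} {C : ℝ}
    (ha : ∀ n : ℕ, ‖a n‖ ≤ C * (n : ℝ) ^ (1 / 2 : ℝ)) {σ : ℝ} (hσ : 3 / 2 < σ) :
    Summable fun n : ℕ => ‖a n‖ / (n : ℝ) ^ σ := by
  refine Summable.of_nonneg_of_le (fun n => by positivity) (fun n => ?_)
    ((Real.summable_nat_rpow.mpr (show 1 / 2 - σ < -1 by linarith)).mul_left C)
  rcases Nat.eq_zero_or_pos n with rfl | hn
  · have h1 : (1 / 2 - σ : ℝ) ≠ 0 := by linarith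
    have h2 : σ ≠ 0 := by linarith
    rw [Nat.cast_zero, Real.zero_rpow h1, Real.zero_rpow h2, div_zero, mul_zero]
  · have hn' : (0 : ℝ) < n := by exact_mod_cast hn
    rw [Real.rpow_sub hn', ← mul_div_assoc]
    gcongr
    exact ha n

theorem IsHeckeEigenform.heckeLFunction_mul_tsum (hf : IsHeckeEigenform f) {s : ℂ}
    (hs : 3 / 2 < s.re) :
    heckeLFunction hω f s * ∑' n : ℕ, normalizedCoeffInv f n / (n : ℂ) ^ s = 1 := by
  obtain ⟨C, -, hC⟩ := exists_norm_normalizedCoeff_le hω f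
  obtain ⟨D, -, hD⟩ := hf.exists_norm_normalizedCoeffInv_le hω
  have hterm (a : ArithmeticFunction ℂ) (n : ℕ) :
      LSeries.term (fun n => a n) s n = a n / (n : ℂ) ^ s := by
    rw [LSeries.term_def]
    split_ifs with h
    · simp [h]
    · rfl
  have hsum {a : ArithmeticFunction ℂ} {C : ℝ}
      (ha : ∀ n : ℕ, ‖a n‖ ≤ C * (n : ℝ) ^ (1 / 2 : ℝ)) : LSeriesSummable (fun n => a n) s := by
    refine Summable.of_norm ?_
    simp_rw [hterm, norm_div_natCast_cpow _ a.map_zero]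
    exact summable_norm_div_rpow ha hs
  have h := ArithmeticFunction.LSeries_mul' (hsum hC) (hsum hD)
  rw [normalizedCoeff_mul_inv f hf.normalizedCoeff_one_ne_zero] at h
  have h1 : LSeries (fun n => (1 : ArithmeticFunction ℂ) n) s = 1 := by
    rw [ArithmeticFunction.one_eq_delta]
    exact congr_fun LSeries_delta s
  rw [h1] at h
  simp only [LSeries, hterm] at h
  rw [(hasSum_heckeLFunction hω f hs).tsum_eq] at h
  exact h.symm

theorem exists_norm_tsum_div_cpow_le {a : ℕ → ℂ} {C : ℝ}
    (ha : ∀ n : ℕ, ‖a n‖ ≤ C * (n : ℝ) ^ (1 / 2 : ℝ)) :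
    ∃ B : ℝ, ∀ s : ℂ, 2 ≤ s.re → ‖∑' n : ℕ, a n / (n : ℂ) ^ s‖ ≤ B := by
  have h0 : a 0 = 0 := by
    have := ha 0
    rw [Nat.cast_zero, Real.zero_rpow (by norm_num), mul_zero] at this
    exact norm_le_zero_iff.mp this
  refine ⟨∑' n : ℕ, ‖a n‖ / (n : ℝ) ^ (2 : ℝ), fun s hs => ?_⟩
  refine tsum_of_norm_bounded (summable_norm_div_rpow ha (by norm_num)).hasSum fun n => ?_
  rw [norm_div_natCast_cpow a h0]
  rcases Nat.eq_zero_or_pos n with rfl | hn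
  · simp [h0]
  · have hn' : (1 : ℝ) ≤ n := by exact_mod_cast hn
    gcongr

theorem IsHeckeEigenform.exists_norm_heckeLFunction_le (hf : IsHeckeEigenform f) :
    ∃ B : ℝ, 0 < B ∧ ∀ s : ℂ, 2 ≤ s.re →
      heckeLFunction hω f s ≠ 0 ∧ ‖heckeLFunction hω f s‖ ≤ B ∧
        ‖(heckeLFunction hω f s)⁻¹‖ ≤ B := by
  obtain ⟨C, -, hC⟩ := exists_norm_normalizedCoeff_le hω f
  obtain ⟨D, -, hD⟩ := hf.exists_norm_normalizedCoeffInv_le hω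
  obtain ⟨B₁, h₁⟩ := exists_norm_tsum_div_cpow_le hC
  obtain ⟨B₂, h₂⟩ := exists_norm_tsum_div_cpow_le hD
  refine ⟨max 1 (max B₁ B₂), by positivity, fun s hs => ?_⟩
  have hs' : 3 / 2 < s.re := by linarith
  have hm := hf.heckeLFunction_mul_tsum hω hs'
  refine ⟨left_ne_zero_of_mul_eq_one hm, ?_, ?_⟩
  · rw [← (hasSum_heckeLFunction hω f hs').tsum_eq]
    exact (h₁ s hs).trans ((le_max_left _ _).trans (le_max_right _ _))
  · rw [inv_eq_of_mul_eq_one_right hm]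
    exact (h₂ s hs).trans ((le_max_right _ _).trans (le_max_right _ _))

/-- A nontrivial zero with `re s < 1 / 2` is a zero of `Λ`, hence reflects to a zero at `1 - s`.
Since `ω ≥ 12`, the trivial zeros have `re s ≤ -11 / 2`. -/
theorem IsHeckeEigenform.heckeRiemannHypothesis_iff (hf : IsHeckeEigenform f) :
    HeckeRiemannHypothesis hω f ↔ ∀ s : ℂ, 1 / 2 < s.re → heckeLFunction hω f s ≠ 0 := by
  have hω' : (12 : ℝ) ≤ ω := by exact_mod_cast twelve_le_weight_of_cuspForm_ne_zero hf.1
  have hre (s : ℂ) : (s + ((ω : ℂ) - 1) / 2).re = s.re + ((ω : ℝ) - 1) / 2 := by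
    simp [Complex.add_re]
  have hpi : (2 * Real.pi : ℂ) ≠ 0 := by exact_mod_cast Real.two_pi_pos.ne'
  constructor
  · intro h s hs h0
    have := h s h0 (by
      rintro ⟨m, hm⟩
      have h1 := congr_arg Complex.re hm
      simp at h1
      have : (0 : ℝ) ≤ m := m.cast_nonneg
      linarith)
    linarith
  · intro h s h0 hs
    by_contra hne
    rcases lt_or_gt_of_ne hne with hlt | hgt
    · have hΓ : Complex.Gamma (s + ((ω : ℂ) - 1) / 2) ≠ 0 := by
        refine Complex.Gamma_ne_zero fun m hm => hs ⟨m, ?_⟩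
        linear_combination hm
      rw [heckeLFunction_eq] at h0
      have hΛ : ModularForm.Λ hω f (s + ((ω : ℂ) - 1) / 2) = 0 :=
        (mul_eq_zero.mp h0).resolve_right
          (mul_ne_zero (by simp [Complex.cpow_eq_zero_iff, hpi]) (inv_ne_zero hΓ))
      refine h (1 - s) (by simp; linarith) ?_
      rw [heckeLFunction_eq, show 1 - s + ((ω : ℂ) - 1) / 2 = ω - (s + ((ω : ℂ) - 1) / 2) by ring,
        CuspForm.completedL_functional_equation, hΛ]
      simp
    · exact h s hgt h0

/-- On the line `re s = -1` the functional equation bounds `L(f, s)` by `L(f, 1 - s)` and an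
explicit polynomial. -/
theorem norm_heckeLFunction_le_of_re_eq_neg_one (hω' : 12 ≤ ω) {s : ℂ} (hs : s.re = -1) :
    ‖heckeLFunction hω f s‖ ≤ ‖heckeLFunction hω f (1 - s)‖ * ‖s + ((ω : ℂ) + 3) / 2‖ ^ 3 := by
  have hω'' : (12 : ℝ) ≤ ω := by exact_mod_cast hω'
  set u : ℂ := s + ((ω : ℂ) - 1) / 2 with hu
  have hure : u.re = ((ω : ℝ) - 3) / 2 := by simp [hu, hs]; ring
  set v : ℂ := (starRingEnd ℂ) u with hv
  have hvre : v.re = ((ω : ℝ) - 3) / 2 := by simp [hv, hure]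
  have hne (z : ℂ) (hz : 0 < z.re) : z ≠ 0 := by rintro rfl; simp at hz
  have hv0 : v ≠ 0 := hne v (by rw [hvre]; linarith)
  have hv1 : v + 1 ≠ 0 := hne _ (by simp [hvre]; linarith)
  have hv2 : v + 2 ≠ 0 := hne _ (by simp [hvre]; linarith)
  -- The line `re s = -1` is chosen so that the two gamma arguments are `u` and `conj u + 3`. The
  -- quotient of their absolute values is then an exact cubic expression, and Stirling's formula is
  -- avoided.
  have hωu : (ω : ℂ) - u = v + 3 := by
    apply Complex.ext
    · simp [hure, hv]; ring
    · simp [hv]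
  have hΓv : Complex.Gamma (v + 3) = (v + 2) * ((v + 1) * (v * Complex.Gamma v)) := by
    rw [show v + 3 = v + 2 + 1 by ring, Complex.Gamma_add_one _ hv2,
      show v + 2 = v + 1 + 1 by ring, Complex.Gamma_add_one _ hv1, Complex.Gamma_add_one _ hv0]
  have hΓu : ‖Complex.Gamma v‖ = ‖Complex.Gamma u‖ := by
    rw [hv, Complex.Gamma_conj, Complex.norm_conj]
  have hΓ0 : 0 < ‖Complex.Gamma u‖ :=
    norm_pos_iff.mpr (Complex.Gamma_ne_zero_of_re_pos (by rw [hure]; linarith))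
  have hu2 : s + ((ω : ℂ) + 3) / 2 = u + 2 := by rw [hu]; ring
  have hle (a : ℝ) (h0 : 0 ≤ a) (h2 : a ≤ 2) : ‖v + a‖ ≤ ‖u + 2‖ := by
    rw [← Complex.norm_conj (u + 2), map_add, ← hv, Complex.norm_def, Complex.norm_def]
    apply Real.sqrt_le_sqrt
    simp only [Complex.normSq_apply, Complex.add_re, Complex.add_im, Complex.ofReal_re,
      Complex.ofReal_im, hvre, Complex.conj_re, Complex.conj_im, Complex.re_ofNat, Complex.im_ofNat]
    nlinarith
  have hpow (z : ℂ) : ‖(2 * Real.pi : ℂ) ^ z‖ = (2 * Real.pi) ^ z.re := by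
    rw [show (2 * Real.pi : ℂ) = ((2 * Real.pi : ℝ) : ℂ) by push_cast; ring,
      Complex.norm_cpow_eq_rpow_re_of_pos Real.two_pi_pos]
  have hΛ : ‖ModularForm.Λ hω f u‖ = ‖ModularForm.Λ hω f (ω - u)‖ := by
    rw [CuspForm.completedL_functional_equation]
    simp
  rw [heckeLFunction_eq, heckeLFunction_eq,
    show 1 - s + ((ω : ℂ) - 1) / 2 = ω - u by rw [hu]; ring, ← hu, hu2]
  simp only [norm_mul, hΛ, hpow, mul_assoc]
  gcongr ?_ * ?_
  rw [hωu, hΓv]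
  simp only [norm_inv, norm_mul, hΓu]
  have h1 := hle 0 le_rfl zero_le_two
  have h2 := hle 1 zero_le_one one_le_two
  have h3 := hle 2 zero_le_two le_rfl
  simp only [Complex.ofReal_zero, add_zero, Complex.ofReal_one, Complex.ofReal_ofNat] at h1 h2 h3
  have hre : u.re ≤ (v + 3).re := by simp [hvre, hure]
  have hpow' : (2 * Real.pi) ^ u.re ≤ (2 * Real.pi) ^ (v + 3).re :=
    Real.rpow_le_rpow_of_exponent_le (by linarith [Real.pi_gt_three]) hre
  have e0 := norm_pos_iff.mpr hv0
  have e1 := norm_pos_iff.mpr hv1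
  have e2 := norm_pos_iff.mpr hv2
  refine mul_le_mul hpow' ?_ (by positivity) (by positivity)
  rw [inv_le_iff_one_le_mul₀ hΓ0]
  have : ‖v + 2‖ * (‖v + 1‖ * ‖v‖) ≤ ‖u + 2‖ ^ 3 := by
    calc ‖v + 2‖ * (‖v + 1‖ * ‖v‖) ≤ ‖u + 2‖ * (‖u + 2‖ * ‖u + 2‖) := by gcongr
      _ = ‖u + 2‖ ^ 3 := by ring
  rw [show (‖v + 2‖ * (‖v + 1‖ * (‖v‖ * ‖Complex.Gamma u‖)))⁻¹ * ‖u + 2‖ ^ 3 * ‖Complex.Gamma u‖ =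
    ‖u + 2‖ ^ 3 / (‖v + 2‖ * (‖v + 1‖ * ‖v‖)) by field_simp]
  rw [one_le_div (by positivity)]
  exact this

/-- Polynomial growth of `L(f, s)` in vertical strips, by the Phragmén-Lindelöf principle. -/
theorem IsHeckeEigenform.exists_norm_heckeLFunction_le_pow (hf : IsHeckeEigenform f) :
    ∃ C : ℝ, 0 < C ∧ ∀ s : ℂ, -1 ≤ s.re →
      ‖heckeLFunction hω f s‖ ≤ C * ‖s + ((ω : ℂ) + 3) / 2‖ ^ 3 := by
  have hω' : (12 : ℝ) ≤ ω := by exact_mod_cast twelve_le_weight_of_cuspForm_ne_zero hf.1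
  obtain ⟨B, hB0, hB⟩ := hf.exists_norm_heckeLFunction_le hω
  have hpi : (2 * Real.pi : ℂ) ≠ 0 := by exact_mod_cast Real.two_pi_pos.ne'
  have hone : ∀ s : ℂ, -1 ≤ s.re → 1 ≤ ‖s + ((ω : ℂ) + 3) / 2‖ := fun s hs => by
    refine le_trans ?_ (Complex.re_le_norm _)
    simp
    linarith
  refine ⟨B, hB0, fun s hs => ?_⟩
  rcases le_or_gt 2 s.re with h2 | h2
  · refine (hB s h2).2.1.trans (le_mul_of_one_le_right hB0.le ?_)
    exact one_le_pow₀ (hone s hs)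
  -- Division by the cube makes the function bounded on both edges `re s = -1` and `re s = 2`.
  set G : ℂ → ℂ := fun s => heckeLFunction hω f s / (s + ((ω : ℂ) + 3) / 2) ^ 3 with hG
  have hne : ∀ s : ℂ, -1 ≤ s.re → (s + ((ω : ℂ) + 3) / 2) ≠ 0 := fun s hs =>
    norm_pos_iff.mp (one_pos.trans_le (hone s hs))
  have hGL : ∀ s : ℂ, -1 ≤ s.re → ‖G s‖ ≤ ‖heckeLFunction hω f s‖ := fun s hs => by
    rw [hG, norm_div, norm_pow]
    exact div_le_self (norm_nonneg _) (one_le_pow₀ (hone s hs))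
  have hclos : closure (Complex.re ⁻¹' Set.Ioo (-1) 2) = Complex.re ⁻¹' Set.Icc (-1) 2 := by
    rw [← closure_Ioo (by norm_num : (-1 : ℝ) ≠ 2), Complex.closure_preimage_re]
  have hdiff : DiffContOnCl ℂ G (Complex.re ⁻¹' Set.Ioo (-1) 2) := by
    refine DifferentiableOn.diffContOnCl ?_
    rw [hclos]
    intro z hz
    have h1 := differentiable_heckeLFunction hω f z
    have h2 : (z + ((ω : ℂ) + 3) / 2) ^ 3 ≠ 0 := pow_ne_zero 3 (hne z hz.1)
    exact (h1.div (by fun_prop) h2).differentiableWithinAt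
  have key : ‖G s‖ ≤ B := by
    -- The strip has width 3, so growth `exp (π * exp |im s|)` is admissible because `1 < π / 3`.
    refine PhragmenLindelof.vertical_strip hdiff ⟨1, ?_, Real.pi, ?_⟩ ?_ ?_ hs h2.le
    · rw [lt_div_iff₀ (by norm_num)]
      linarith [Real.pi_gt_three]
    · obtain ⟨C₁, hC₁, h₁⟩ := CuspForm.exists_norm_completedL_le hω f (((ω : ℝ) - 3) / 2)
        (((ω : ℝ) + 3) / 2)
      obtain ⟨C₂, hC₂, h₂⟩ := Complex.exists_norm_Gamma_inv_le (((ω : ℝ) - 3) / 2)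
        (((ω : ℝ) + 3) / 2)
      refine Asymptotics.IsBigO.of_bound
        (C₁ * ((2 * Real.pi) ^ (((ω : ℝ) + 3) / 2) * C₂)) ?_
      have hev : ∀ᶠ z : ℂ in Filter.comap (_root_.abs ∘ Complex.im) Filter.atTop,
          1 ≤ |z.im| := Filter.tendsto_comap.eventually_ge_atTop 1
      filter_upwards [hev.filter_mono inf_le_left,
        Filter.mem_inf_of_right (Filter.mem_principal_self _)] with z hz1 hz2
      refine (hGL z hz2.1.le).trans ?_
      have e1 : (z + ((ω : ℂ) - 1) / 2).re = z.re + ((ω : ℝ) - 1) / 2 := by simp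
      have e2 : (z + ((ω : ℂ) - 1) / 2).im = z.im := by simp
      have hz3 := hz2.1
      have hz4 := hz2.2
      have b1 := h₁ (z + ((ω : ℂ) - 1) / 2) (by rw [e1]; linarith) (by rw [e1]; linarith)
      have b2 := h₂ (z + ((ω : ℂ) - 1) / 2) (by rw [e1]; linarith) (by rw [e1]; linarith)
        (by rwa [e2])
      have b3 : ‖(2 * Real.pi : ℂ) ^ (z + ((ω : ℂ) - 1) / 2)‖ ≤
          (2 * Real.pi) ^ (((ω : ℝ) + 3) / 2) := by
        rw [show (2 * Real.pi : ℂ) = ((2 * Real.pi : ℝ) : ℂ) by push_cast; ring,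
          Complex.norm_cpow_eq_rpow_re_of_pos Real.two_pi_pos, e1]
        exact Real.rpow_le_rpow_of_exponent_le (by linarith [Real.pi_gt_three]) (by linarith)
      rw [e2] at b2
      rw [heckeLFunction_eq, norm_mul, norm_mul, Real.norm_of_nonneg (Real.exp_pos _).le, one_mul,
        mul_assoc, mul_assoc]
      have b4 : Real.exp (Real.pi * |z.im|) ≤ Real.exp (Real.pi * Real.exp |z.im|) := by
        have := Real.add_one_le_exp |z.im|
        gcongr
        linarith
      gcongr
      exact b2.trans (by gcongr)
    · intro z hz
      rw [hG, norm_div, norm_pow, div_le_iff₀ (by have := hone z hz.ge; positivity)]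
      refine (norm_heckeLFunction_le_of_re_eq_neg_one hω
        (twelve_le_weight_of_cuspForm_ne_zero hf.1) hz).trans ?_
      gcongr
      exact (hB (1 - z) (by simp [hz]; norm_num)).2.1
    · intro z hz
      exact (hGL z (by rw [hz]; norm_num)).trans (hB z hz.ge).2.1
  rw [hG, norm_div, norm_pow, div_le_iff₀ (by have := hone s hs; positivity)] at key
  exact key

/-- If `L(f, s)` has no zeros in `re s > 1 / 2`, then `1 / L(f, s)` has polynomial growth to the
right of every line `re s = 1 / 2 + δ`. -/
theorem IsHeckeEigenform.exists_norm_heckeLFunction_inv_le (hf : IsHeckeEigenform f)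
    (h0 : ∀ s : ℂ, 1 / 2 < s.re → heckeLFunction hω f s ≠ 0) {δ : ℝ} (hδ : 0 < δ) :
    ∃ C : ℝ, ∃ N : ℕ, 0 ≤ C ∧ ∀ s : ℂ, 1 / 2 + δ ≤ s.re →
      ‖(heckeLFunction hω f s)⁻¹‖ ≤ C * (1 + |s.im|) ^ N := by
  have hω' : (12 : ℝ) ≤ ω := by exact_mod_cast twelve_le_weight_of_cuspForm_ne_zero hf.1
  obtain ⟨B, hB0, hB⟩ := hf.exists_norm_heckeLFunction_le hω
  obtain ⟨C, hC0, hC⟩ := hf.exists_norm_heckeLFunction_le_pow hω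
  -- With radii `R = 3 / 2` and `r = R - δ` below, the exponent `2 M R / (R - r)` equals `3 M / δ`.
  obtain ⟨n, hn⟩ := exists_nat_ge (3 / δ)
  set A : ℝ := 5 + ((ω : ℝ) + 3) / 2 with hA
  set D : ℝ := 2 + B * (C * A ^ 3) with hD
  have hA0 : 0 < A := by rw [hA]; linarith
  have hD2 : 2 ≤ D := by rw [hD]; linarith [show 0 < B * (C * A ^ 3) by positivity]
  refine ⟨B * D ^ n, 3 * n, by positivity, fun s hs => ?_⟩
  obtain ⟨τ, hτdef⟩ : ∃ τ : ℝ, τ = 1 + |s.im| := ⟨_, rfl⟩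
  have hτ : 1 ≤ τ := by rw [hτdef]; linarith [abs_nonneg s.im]
  rw [← hτdef]
  have hDn : 1 ≤ D ^ n := one_le_pow₀ (by linarith)
  rcases le_or_gt 2 s.re with h2 | h2
  · refine (hB s h2).2.2.trans ?_
    rw [mul_assoc]
    exact le_mul_of_one_le_right hB0.le (one_le_mul_of_one_le_of_one_le hDn (one_le_pow₀ hτ))
  -- The disc of radius `3 / 2` about `c` touches the line `re w = 1 / 2`, and `s` lies on its
  -- horizontal radius.
  set c : ℂ := 2 + s.im * Complex.I with hc
  have hcre : c.re = 2 := by simp [hc]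
  have hball : ∀ w ∈ Metric.ball c (3 / 2), 1 / 2 < w.re := by
    intro w hw
    have h1 : ‖w - c‖ < 3 / 2 := by simpa [dist_eq_norm] using hw
    have h4 := (neg_le_abs (w - c).re).trans_lt ((Complex.abs_re_le_norm (w - c)).trans_lt h1)
    rw [Complex.sub_re, hcre] at h4
    linarith
  set M : ℝ := Real.log (D * τ ^ 3) with hM
  have hτ3 : 1 ≤ τ ^ 3 := one_le_pow₀ hτ
  have hDτ : 2 ≤ D * τ ^ 3 := by nlinarith
  have hexpM : Real.exp M = D * τ ^ 3 := Real.exp_log (by linarith)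
  have hM0 : 0 < M := Real.log_pos (by linarith)
  have hLc := hB c hcre.ge
  have key := norm_inv_le_of_norm_le_on_ball (F := heckeLFunction hω f) (c := c) (z := s)
    (R := 3 / 2) (r := 3 / 2 - δ) (M := M) (by linarith) (by norm_num) hM0
    (differentiable_heckeLFunction hω f).differentiableOn (fun w hw => h0 w (hball w hw))
    (fun w hw => by
      have hw' : ‖w - c‖ < 3 / 2 := by simpa [dist_eq_norm] using hw
      have h1 := hC w (by linarith [hball w hw])
      have h3 : ‖w + ((ω : ℂ) + 3) / 2‖ ≤ A * τ := by
        have e : w + ((ω : ℂ) + 3) / 2 =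
            (w - c) + ((2 + ((ω : ℝ) + 3) / 2 : ℝ) : ℂ) + s.im * Complex.I := by
          rw [hc]; push_cast; ring
        rw [e]
        refine (norm_add₃_le).trans ?_
        rw [Complex.norm_real, norm_mul, Complex.norm_I, mul_one, Complex.norm_real,
          Real.norm_of_nonneg (by linarith), Real.norm_eq_abs, hA]
        have h6 : |s.im| ≤ τ := by rw [hτdef]; linarith
        nlinarith
      have h5 : 1 ≤ B * ‖heckeLFunction hω f c‖ := by
        have := hLc.2.2
        rwa [norm_inv, inv_le_iff_one_le_mul₀ (norm_pos_iff.mpr hLc.1)] at this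
      calc ‖heckeLFunction hω f w‖ ≤ C * (A * τ) ^ 3 := h1.trans (by gcongr)
        _ ≤ (B * ‖heckeLFunction hω f c‖) * (C * (A * τ) ^ 3) :=
          le_mul_of_one_le_left (by positivity) h5
        _ = ‖heckeLFunction hω f c‖ * (B * (C * A ^ 3) * τ ^ 3) := by ring
        _ ≤ ‖heckeLFunction hω f c‖ * (D * τ ^ 3) := by gcongr; rw [hD]; linarith
        _ = _ := by rw [hexpM])
    (by
      have e : s - c = ((s.re - 2 : ℝ) : ℂ) := by
        apply Complex.ext <;> simp [hc]
      rw [e, Complex.norm_real, Real.norm_of_nonpos (by linarith)]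
      linarith)
  refine key.trans ?_
  rw [mul_assoc B]
  refine mul_le_mul hLc.2.2 ?_ (Real.exp_pos _).le hB0.le
  calc Real.exp (2 * M * (3 / 2) / (3 / 2 - (3 / 2 - δ))) ≤ Real.exp (n * M) := by
        rw [Real.exp_le_exp, show 2 * M * (3 / 2) / (3 / 2 - (3 / 2 - δ)) = 3 / δ * M by
          rw [sub_sub_cancel]; ring]
        gcongr
    _ = D ^ n * τ ^ (3 * n) := by
        rw [Real.exp_nat_mul, hexpM, mul_pow, pow_mul]

end HeckeLFunction

/-! ### Integrals along vertical lines. -/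

section VerticalIntegrals

theorem Complex.verticalIntegrable_of_norm_le {F : ℂ → ℂ} {a C : ℝ}
    (hF : Continuous fun t : ℝ => F (a + t * Complex.I))
    (hC : ∀ s : ℂ, s.re = a → 1 ≤ |s.im| → ‖F s‖ * |s.im| ^ 2 ≤ C) :
    Complex.VerticalIntegrable F a := by
  obtain ⟨K, hK⟩ := isCompact_Icc.exists_bound_of_continuousOn (s := Set.Icc (-1 : ℝ) 1)
    hF.continuousOn
  refine MeasureTheory.Integrable.mono' (integrable_inv_one_add_sq.const_mul (2 * max K C))
    hF.aestronglyMeasurable (.of_forall fun t => ?_)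
  rw [← div_eq_mul_inv, le_div_iff₀ (by positivity)]
  rcases le_total |t| 1 with h | h
  · have h1 := hK t (abs_le.mp h)
    have h2 : t ^ 2 ≤ 1 := (sq_le_one_iff_abs_le_one t).mpr h
    have h3 : ‖F (a + t * Complex.I)‖ ≤ max K C := h1.trans (le_max_left _ _)
    nlinarith [norm_nonneg (F (a + t * Complex.I))]
  · have h1 := hC (a + t * Complex.I) (by simp) (by simpa using h)
    have e : ((a : ℂ) + t * Complex.I).im = t := by simp
    rw [e, sq_abs] at h1
    have h2 : 1 ≤ t ^ 2 := (one_le_sq_iff_one_le_abs t).mpr h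
    have h3 : ‖F (a + t * Complex.I)‖ * t ^ 2 ≤ max K C := h1.trans (le_max_right _ _)
    nlinarith [norm_nonneg (F (a + t * Complex.I))]

theorem Complex.continuous_vertical_of_differentiableOn {F : ℂ → ℂ} {a b c : ℝ} (h1 : a ≤ c)
    (h2 : c ≤ b) (hF : DifferentiableOn ℂ F (Complex.re ⁻¹' Set.Icc a b)) :
    Continuous fun t : ℝ => F (c + t * Complex.I) := by
  refine hF.continuousOn.comp_continuous (by fun_prop) fun t => ?_
  simp [h1, h2]

/-- Shifting the line of integration. -/
theorem Complex.integral_vertical_eq {F : ℂ → ℂ} {a b C : ℝ} (hab : a ≤ b)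
    (hF : DifferentiableOn ℂ F (Complex.re ⁻¹' Set.Icc a b))
    (hC : ∀ s : ℂ, a ≤ s.re → s.re ≤ b → 1 ≤ |s.im| → ‖F s‖ * |s.im| ^ 2 ≤ C) :
    ∫ t : ℝ, F (a + t * Complex.I) = ∫ t : ℝ, F (b + t * Complex.I) := by
  have hlim (c : ℝ) (h1 : a ≤ c) (h2 : c ≤ b) : Filter.Tendsto
      (fun T : ℝ => ∫ t in (-T)..T, F (c + t * Complex.I)) Filter.atTop
      (nhds (∫ t : ℝ, F (c + t * Complex.I))) :=
    MeasureTheory.intervalIntegral_tendsto_integral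
      (Complex.verticalIntegrable_of_norm_le
        (Complex.continuous_vertical_of_differentiableOn h1 h2 hF)
        (fun s hs => hC s (hs ▸ h1) (hs ▸ h2)))
      Filter.tendsto_neg_atTop_atBot Filter.tendsto_id
  -- The horizontal sides of the rectangle, at heights `T` and `-T`, contribute `O(T ^ (-2))`.
  have hhor (ε : ℝ) (hε : |ε| = 1) : Filter.Tendsto
      (fun T : ℝ => ∫ x in a..b, F (x + ((ε * T : ℝ) : ℂ) * Complex.I)) Filter.atTop (nhds 0) := by
    refine squeeze_zero_norm' (a := fun T : ℝ => C * |b - a| * (T ^ 2)⁻¹) ?_ ?_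
    · filter_upwards [Filter.eventually_ge_atTop 1] with T hT
      have hT' : |ε * T| = T := by rw [abs_mul, hε, one_mul, abs_of_pos (by linarith)]
      have : ‖∫ x in a..b, F (x + ((ε * T : ℝ) : ℂ) * Complex.I)‖ ≤ C * (T ^ 2)⁻¹ * |b - a| := by
        refine intervalIntegral.norm_integral_le_of_norm_le_const fun x hx => ?_
        rw [Set.uIoc_of_le hab] at hx
        have e1 : ((x : ℂ) + ((ε * T : ℝ) : ℂ) * Complex.I).re = x := by simp
        have e2 : ((x : ℂ) + ((ε * T : ℝ) : ℂ) * Complex.I).im = ε * T := by simp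
        have := hC (x + ((ε * T : ℝ) : ℂ) * Complex.I) (by rw [e1]; exact hx.1.le)
          (by rw [e1]; exact hx.2) (by rw [e2, hT']; exact hT)
        rw [e2, hT'] at this
        rwa [← div_eq_mul_inv, le_div_iff₀ (by positivity)]
      exact this.trans (le_of_eq (by ring))
    · have := (tendsto_inv_atTop_zero.comp
        (Filter.tendsto_pow_atTop (α := ℝ) two_ne_zero)).const_mul (C * |b - a|)
      simpa using this
  have hrect : ∀ T : ℝ, (∫ x in a..b, F (x + ((-1 * T : ℝ) : ℂ) * Complex.I)) -
      (∫ x in a..b, F (x + ((1 * T : ℝ) : ℂ) * Complex.I)) +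
      Complex.I * (∫ y in (-T)..T, F (b + y * Complex.I)) -
      Complex.I * (∫ y in (-T)..T, F (a + y * Complex.I)) = 0 := by
    intro T
    have := Complex.integral_boundary_rect_eq_zero_of_differentiableOn F ⟨a, -T⟩ ⟨b, T⟩
      (hF.mono fun s hs => by
        have := hs.1
        rwa [Set.uIcc_of_le hab] at this)
    simpa using this
  have h0 := ((((hhor (-1) (by simp)).sub (hhor 1 (by simp))).add
    ((hlim b hab le_rfl).const_mul Complex.I)).sub ((hlim a le_rfl hab).const_mul Complex.I))
  simp_rw [hrect] at h0
  have h1 := tendsto_nhds_unique h0 tendsto_const_nhds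
  rw [sub_zero, zero_add, ← mul_sub] at h1
  exact (sub_eq_zero.mp ((mul_eq_zero.mp h1).resolve_left Complex.I_ne_zero)).symm

end VerticalIntegrals

/-! ### The series `P` and its Mellin transform. -/

section ExponentialSeries

theorem Real.exp_neg_le_mul_rpow_neg {a : ℝ} (ha : 0 < a) {y : ℝ} (hy : 0 < y) :
    Real.exp (-y) ≤ a ^ a * y ^ (-a) := by
  have h1 : y ≤ a * Real.exp (y / a) := by
    have := Real.add_one_le_exp (y / a)
    calc y = a * (y / a) := by field_simp
      _ ≤ a * Real.exp (y / a) := by gcongr; linarith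
  have h2 : y ^ a ≤ a ^ a * Real.exp y := by
    calc y ^ a ≤ (a * Real.exp (y / a)) ^ a := by gcongr
      _ = a ^ a * Real.exp y := by
        rw [Real.mul_rpow ha.le (Real.exp_pos _).le, ← Real.exp_mul]
        congr 2
        field_simp
  rw [Real.exp_neg, Real.rpow_neg hy.le, ← div_eq_mul_inv, le_div_iff₀ (by positivity),
    inv_mul_le_iff₀ (Real.exp_pos _), mul_comm]
  exact h2

/-- The series `∑ h n / n ^ k * exp (-x / n ^ ℓ)`. -/
noncomputable def rieszSeries (h : ℕ → ℂ) (k ℓ x : ℝ) : ℂ :=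
  ∑' n : ℕ, h n / (((n : ℝ) ^ k : ℝ) : ℂ) * ((Real.exp (-x / (n : ℝ) ^ ℓ) : ℝ) : ℂ)

variable {h : ℕ → ℂ} {D k ℓ : ℝ}

theorem norm_rieszSeries_term (h : ℕ → ℂ) (k ℓ x : ℝ) (n : ℕ) :
    ‖h n / (((n : ℝ) ^ k : ℝ) : ℂ) * ((Real.exp (-x / (n : ℝ) ^ ℓ) : ℝ) : ℂ)‖ =
      ‖h n‖ / (n : ℝ) ^ k * Real.exp (-x / (n : ℝ) ^ ℓ) := by
  rw [norm_mul, norm_div, Complex.norm_real, Complex.norm_real,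
    Real.norm_of_nonneg (Real.exp_pos _).le, Real.norm_of_nonneg (by positivity)]

theorem norm_rieszSeries_term_le (h : ℕ → ℂ) (k ℓ : ℝ) {x : ℝ} (hx : 0 ≤ x) (n : ℕ) :
    ‖h n / (((n : ℝ) ^ k : ℝ) : ℂ) * ((Real.exp (-x / (n : ℝ) ^ ℓ) : ℝ) : ℂ)‖ ≤
      ‖h n‖ / (n : ℝ) ^ k := by
  rw [norm_rieszSeries_term]
  refine mul_le_of_le_one_right (by positivity) (Real.exp_le_one_iff.mpr ?_)
  rw [neg_div]
  exact neg_nonpos.mpr (by positivity)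

variable (hh : ∀ n : ℕ, ‖h n‖ ≤ D * (n : ℝ) ^ (1 / 2 : ℝ))

include hh

theorem summable_rieszSeries (hk : 3 / 2 < k) {x : ℝ} (hx : 0 ≤ x) : Summable fun n : ℕ =>
    h n / (((n : ℝ) ^ k : ℝ) : ℂ) * ((Real.exp (-x / (n : ℝ) ^ ℓ) : ℝ) : ℂ) :=
  .of_norm_bounded (summable_norm_div_rpow hh hk) (norm_rieszSeries_term_le h k ℓ hx)

theorem continuousOn_rieszSeries (hk : 3 / 2 < k) :
    ContinuousOn (rieszSeries h k ℓ) (Set.Ioi 0) :=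
  continuousOn_tsum (fun n => by fun_prop) (summable_norm_div_rpow hh hk)
    fun n _ hx => norm_rieszSeries_term_le h k ℓ (le_of_lt hx) n

theorem isBigO_rieszSeries_zero (hk : 3 / 2 < k) :
    rieszSeries h k ℓ =O[nhdsWithin 0 (Set.Ioi 0)] fun x : ℝ => x ^ (-0 : ℝ) := by
  refine .of_bound (∑' n : ℕ, ‖h n‖ / (n : ℝ) ^ k) ?_
  filter_upwards [self_mem_nhdsWithin] with x hx
  rw [neg_zero, Real.rpow_zero, norm_one, mul_one]
  exact tsum_of_norm_bounded (summable_norm_div_rpow hh hk).hasSum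
    (norm_rieszSeries_term_le h k ℓ (le_of_lt hx))

/-- Unconditional decay: `exp (-y) ≪ y ^ (-a)` with `y = x / n ^ ℓ` costs a factor `n ^ (ℓ a)` in
the series. It makes the Mellin integral converge on the initial line. -/
theorem isBigO_rieszSeries_atTop {a : ℝ} (ha : 0 < a) (hka : 3 / 2 < k - ℓ * a) :
    rieszSeries h k ℓ =O[Filter.atTop] fun x : ℝ => x ^ (-a) := by
  refine .of_bound (a ^ a * ∑' n : ℕ, ‖h n‖ / (n : ℝ) ^ (k - ℓ * a)) ?_
  filter_upwards [Filter.eventually_gt_atTop 0] with x hx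
  rw [Real.norm_of_nonneg (by positivity), mul_right_comm]
  refine tsum_of_norm_bounded ((summable_norm_div_rpow hh hka).hasSum.mul_left _) fun n => ?_
  rw [norm_rieszSeries_term]
  rcases Nat.eq_zero_or_pos n with rfl | hn
  · have := hh 0
    rw [Nat.cast_zero, Real.zero_rpow (by norm_num), mul_zero] at this
    rw [le_antisymm this (norm_nonneg _)]
    simp
  have hn' : (0 : ℝ) < n := by exact_mod_cast hn
  have h1 := Real.exp_neg_le_mul_rpow_neg ha (show 0 < x / (n : ℝ) ^ ℓ by positivity)
  rw [neg_div]
  calc ‖h n‖ / (n : ℝ) ^ k * Real.exp (-(x / (n : ℝ) ^ ℓ))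
      ≤ ‖h n‖ / (n : ℝ) ^ k * (a ^ a * (x / (n : ℝ) ^ ℓ) ^ (-a)) := by gcongr
    _ = _ := by
      rw [Real.div_rpow hx.le (by positivity), ← Real.rpow_mul hn'.le, mul_neg, Real.rpow_neg hn'.le,
        Real.rpow_sub hn']
      field_simp

/-- Termwise, the Mellin transform of `exp (-x / n ^ ℓ)` is `Γ(s) n ^ (ℓ s)`. -/
theorem mellin_rieszSeries (hk : 3 / 2 < k) {s : ℂ} (hs : 0 < s.re)
    (hks : 3 / 2 < k - ℓ * s.re) :
    mellin (rieszSeries h k ℓ) s =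
      Complex.Gamma s * ∑' n : ℕ, h n / (n : ℂ) ^ ((k : ℂ) - ℓ * s) := by
  have h0 : h 0 = 0 := by
    have := hh 0
    rw [Nat.cast_zero, Real.zero_rpow (by norm_num), mul_zero] at this
    exact norm_le_zero_iff.mp this
  have key := hasSum_mellin (a := fun n => h n / (((n : ℝ) ^ k : ℝ) : ℂ))
    (p := fun n : ℕ => ((n : ℝ) ^ ℓ)⁻¹) (F := rieszSeries h k ℓ) (s := s)
    (fun n => by
      rcases Nat.eq_zero_or_pos n with rfl | hn
      · simp [h0]
      · exact Or.inr (by positivity)) hs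
    (fun t ht => by
      refine HasSum.congr_fun (summable_rieszSeries (ℓ := ℓ) hh hk (le_of_lt ht)).hasSum fun n => ?_
      rw [neg_mul, inv_mul_eq_div, neg_div])
    (by
      refine (summable_norm_div_rpow hh hks).congr fun n => ?_
      rcases Nat.eq_zero_or_pos n with rfl | hn
      · simp [h0]
      have hn' : (0 : ℝ) < n := by exact_mod_cast hn
      rw [norm_div, Complex.norm_real, Real.norm_of_nonneg (by positivity),
        Real.inv_rpow (by positivity), ← Real.rpow_mul hn'.le, Real.rpow_sub hn']
      field_simp)
  rw [← key.tsum_eq, ← tsum_mul_left]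
  congr 1
  ext n
  rcases Nat.eq_zero_or_pos n with rfl | hn
  · simp [h0]
  have hn' : (0 : ℝ) < n := by exact_mod_cast hn
  have hn0 : (n : ℂ) ≠ 0 := by exact_mod_cast hn.ne'
  rw [mul_div_assoc, div_div]
  congr 2
  rw [← Real.rpow_neg hn'.le, ← Complex.cpow_mul_ofReal_nonneg hn'.le,
    Complex.ofReal_cpow hn'.le, Complex.ofReal_natCast, ← Complex.cpow_add _ _ hn0]
  congr 1
  push_cast
  ring

end ExponentialSeries

/-! ### The two implications of the criterion. -/

section RieszCriterion

variable {ω : ℤ} (hω : 0 < ω) {f : CuspForm 𝒮ℒ ω} {k ℓ : ℝ}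

/-- Stated as a product, the identity can be continued analytically before `L` is known not to
vanish. -/
theorem IsHeckeEigenform.mellin_rieszSeries_mul (hf : IsHeckeEigenform f) (hk : 3 / 2 < k)
    {s : ℂ} (hs : 0 < s.re) (hks : 3 / 2 < k - ℓ * s.re) :
    mellin (rieszSeries (fun n => normalizedCoeffInv f n) k ℓ) s *
      heckeLFunction hω f (k - ℓ * s) = Complex.Gamma s := by
  obtain ⟨D, -, hD⟩ := hf.exists_norm_normalizedCoeffInv_le hω
  rw [mellin_rieszSeries hD hk hs hks, mul_assoc, mul_comm (∑' _, _),
    hf.heckeLFunction_mul_tsum hω (by simpa using hks), mul_one]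

theorem IsHeckeEigenform.heckeLFunction_ne_zero_of_isBigO (hf : IsHeckeEigenform f)
    (hk : 2 < k) (hℓ : 0 < ℓ)
    (hO : ∀ ε : ℝ, 0 < ε → rieszSeries (fun n => normalizedCoeffInv f n) k ℓ
      =O[Filter.atTop] fun x : ℝ => x ^ (-k / ℓ + 1 / (2 * ℓ) + ε))
    {w : ℂ} (hw : 1 / 2 < w.re) : heckeLFunction hω f w ≠ 0 := by
  obtain ⟨D, -, hD⟩ := hf.exists_norm_normalizedCoeffInv_le hω
  rcases lt_or_ge (3 / 2) w.re with h | h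
  · exact left_ne_zero_of_mul_eq_one (hf.heckeLFunction_mul_tsum hω h)
  set P := rieszSeries (fun n => normalizedCoeffInv f n) k ℓ with hP
  set U : Set ℂ := Complex.re ⁻¹' Set.Ioo 0 ((k - 1 / 2) / ℓ) with hU
  have hUo : IsOpen U := isOpen_Ioo.preimage Complex.continuous_re
  have hUc : IsPreconnected U :=
    ((convex_Ioo _ _).linear_preimage Complex.reLm).isPreconnected
  have hmem (v : ℂ) (h1 : 1 / 2 < v.re) (h2 : v.re < k) : (k - v) / ℓ ∈ U := by
    rw [hU, Set.mem_preimage, Complex.div_ofReal_re, Complex.sub_re, Complex.ofReal_re]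
    exact ⟨div_pos (by linarith) hℓ, by gcongr⟩
  have hℓ0 : (ℓ : ℂ) ≠ 0 := by exact_mod_cast hℓ.ne'
  have hdiff : DifferentiableOn ℂ (mellin P) U := by
    intro s hs
    set ε : ℝ := ((k - 1 / 2) / ℓ - s.re) / 2 with hε
    have hε0 : 0 < ε := by have := hs.2; rw [hε]; linarith
    have hO' : P =O[Filter.atTop] fun x : ℝ => x ^ (-((k - 1 / 2) / ℓ - ε)) := by
      convert hO ε hε0 using 3
      field_simp
      ring
    exact (mellin_differentiableAt_of_isBigO_rpow
      ((continuousOn_rieszSeries hD (by linarith)).locallyIntegrableOn measurableSet_Ioi)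
      hO' (by rw [hε]; linarith [hs.2]) (isBigO_rieszSeries_zero hD (by linarith))
      hs.1).differentiableWithinAt
  have hleft : AnalyticOnNhd ℂ (fun s => mellin P s * heckeLFunction hω f (k - ℓ * s)) U := by
    refine DifferentiableOn.analyticOnNhd (hdiff.mul ?_) hUo
    exact ((differentiable_heckeLFunction hω f).comp (by fun_prop)).differentiableOn
  have hright : AnalyticOnNhd ℂ Complex.Gamma U := by
    refine DifferentiableOn.analyticOnNhd (fun s hs => ?_) hUo
    refine (Complex.differentiableAt_Gamma s fun m hm => ?_).differentiableWithinAt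
    have := hs.1
    rw [hm] at this
    simp at this
    linarith [(m.cast_nonneg : (0 : ℝ) ≤ m)]
  -- The base point corresponds to `w = (k + 3 / 2) / 2`, between `3 / 2` and `k`, where the
  -- Dirichlet series for `1 / L` converges and `re s > 0`.
  have heq := hleft.eqOn_of_preconnected_of_eventuallyEq hright hUc
    (hmem (((k + 3 / 2) / 2 : ℝ) : ℂ) (by simp; linarith) (by simp; linarith)) (by
      have hV : IsOpen ({s : ℂ | 0 < s.re} ∩ {s : ℂ | 3 / 2 < k - ℓ * s.re}) :=
        (isOpen_lt continuous_const Complex.continuous_re).inter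
          (isOpen_lt continuous_const (by fun_prop))
      filter_upwards [hV.mem_nhds (by
        rw [Set.mem_inter_iff, Set.mem_ofPred_eq, Set.mem_ofPred_eq, Complex.div_ofReal_re, Complex.sub_re, Complex.ofReal_re,
          Complex.ofReal_re, mul_div_cancel₀ _ hℓ.ne']
        exact ⟨div_pos (by linarith) hℓ, by linarith⟩)] with s hs
      exact hf.mellin_rieszSeries_mul hω (by linarith) hs.1 hs.2)
  have hwU := hmem w hw (by linarith)
  have hfin := heq hwU
  simp only [mul_div_cancel₀ _ hℓ0, sub_sub_cancel] at hfin
  intro h0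
  rw [h0, mul_zero] at hfin
  exact Complex.Gamma_ne_zero_of_re_pos hwU.1 hfin.symm

theorem IsHeckeEigenform.exists_norm_rieszSeries_le (hf : IsHeckeEigenform f)
    (hk : 4 < k) (hℓ : 0 < ℓ)
    (h0 : ∀ s : ℂ, 1 / 2 < s.re → heckeLFunction hω f s ≠ 0) {c' : ℝ} (hc1 : (k - 3) / ℓ ≤ c')
    (hc2 : c' < (k - 1 / 2) / ℓ) :
    ∃ C : ℝ, ∀ x : ℝ, 1 ≤ x →
      ‖rieszSeries (fun n => normalizedCoeffInv f n) k ℓ x‖ ≤ C * x ^ (-c') := by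
  obtain ⟨D, -, hD⟩ := hf.exists_norm_normalizedCoeffInv_le hω
  set P := rieszSeries (fun n => normalizedCoeffInv f n) k ℓ with hP
  -- On `re s = c` one has `re (k - ℓ s) = 3`, inside the region of absolute convergence.
  set c : ℝ := (k - 3) / ℓ with hc
  have hc0 : 0 < c := div_pos (by linarith) hℓ
  have hℓc : ℓ * c = k - 3 := mul_div_cancel₀ _ hℓ.ne'
  have hℓc' : ℓ * c' < k - 1 / 2 := by rwa [lt_div_iff₀ hℓ, mul_comm] at hc2
  set δ : ℝ := k - 1 / 2 - ℓ * c' with hδ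
  have hδ0 : 0 < δ := by rw [hδ]; linarith
  set G : ℂ → ℂ := fun s => Complex.Gamma s * (heckeLFunction hω f (k - ℓ * s))⁻¹ with hG
  have hre (s : ℂ) : ((k : ℂ) - ℓ * s).re = k - ℓ * s.re := by simp
  have hhalf {s : ℂ} (hs : s.re ≤ c') : 1 / 2 + δ ≤ ((k : ℂ) - ℓ * s).re := by
    have : ℓ * s.re ≤ ℓ * c' := by gcongr
    rw [hre, hδ]
    linarith
  have hGd : DifferentiableOn ℂ G (Complex.re ⁻¹' Set.Icc c c') := by
    intro s hs
    have h1 : DifferentiableAt ℂ Complex.Gamma s :=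
      Complex.differentiableAt_Gamma s fun m hm => by
        have := hs.1
        rw [hm] at this
        simp at this
        linarith [(m.cast_nonneg : (0 : ℝ) ≤ m)]
    have h2 : DifferentiableAt ℂ (fun s : ℂ => heckeLFunction hω f (k - ℓ * s)) s :=
      ((differentiable_heckeLFunction hω f).comp (by fun_prop)) s
    exact (h1.mul (h2.inv (h0 _ (by linarith [hhalf hs.2])))).differentiableWithinAt
  obtain ⟨K, hK⟩ : ∃ K : ℝ, ∀ s : ℂ, c ≤ s.re → s.re ≤ c' → 1 ≤ |s.im| →
      ‖G s‖ * |s.im| ^ 2 ≤ K := by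
    obtain ⟨A, N, hA0, hA⟩ := hf.exists_norm_heckeLFunction_inv_le hω h0 hδ0
    obtain ⟨B, hB0, hB⟩ := Complex.exists_norm_Gamma_mul_pow_le (N + 2) c c'
    refine ⟨A * (1 + ℓ) ^ N * B, fun s h1 h2 h3 => ?_⟩
    have e1 := hA _ (hhalf h2)
    have e2 : |((k : ℂ) - ℓ * s).im| = ℓ * |s.im| := by
      simp [abs_mul, abs_of_pos hℓ]
    rw [e2] at e1
    have e3 : 1 + ℓ * |s.im| ≤ (1 + ℓ) * |s.im| := by linarith
    rw [hG, norm_mul]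
    calc ‖Complex.Gamma s‖ * ‖(heckeLFunction hω f (k - ℓ * s))⁻¹‖ * |s.im| ^ 2
        ≤ ‖Complex.Gamma s‖ * (A * ((1 + ℓ) * |s.im|) ^ N) * |s.im| ^ 2 := by
          gcongr
          exact e1.trans (by gcongr)
      _ = A * (1 + ℓ) ^ N * (‖Complex.Gamma s‖ * |s.im| ^ (N + 2)) := by
          rw [mul_pow]; ring
      _ ≤ A * (1 + ℓ) ^ N * B := by gcongr; exact hB s h1 h2 h3
  have hline : ∀ y : ℝ, mellin P (c + y * Complex.I) = G (c + y * Complex.I) := by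
    intro y
    have e : ((c : ℂ) + y * Complex.I).re = c := by simp
    rw [hG, eq_mul_inv_iff_mul_eq₀ (h0 _ (by rw [hre, e, hℓc]; linarith))]
    exact hf.mellin_rieszSeries_mul hω (by linarith) (by rwa [e]) (by rw [e, hℓc]; linarith)
  have hGc : Complex.VerticalIntegrable G c := Complex.verticalIntegrable_of_norm_le
    (Complex.continuous_vertical_of_differentiableOn le_rfl hc1 hGd)
    fun s hs => hK s hs.ge (hs.trans_le hc1)
  refine ⟨1 / (2 * Real.pi) * ∫ y : ℝ, ‖G (c' + y * Complex.I)‖, fun x hx => ?_⟩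
  have hx0 : 0 < x := one_pos.trans_le hx
  have hxC : (x : ℂ) ≠ 0 := by exact_mod_cast hx0.ne'
  have hinv : mellinInv c (mellin P) x = P x := by
    refine mellinInv_mellin_eq c P hx0 ?_ ?_ ?_
    · have hℓa : ℓ * ((k - 2) / ℓ) = k - 2 := mul_div_cancel₀ _ hℓ.ne'
      exact mellinConvergent_of_isBigO_rpow
        ((continuousOn_rieszSeries hD (by linarith)).locallyIntegrableOn measurableSet_Ioi)
        (isBigO_rieszSeries_atTop (a := (k - 2) / ℓ) hD (div_pos (by linarith) hℓ)
          (by rw [hℓa]; linarith))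
        (by rw [Complex.ofReal_re, hc]; gcongr; linarith)
        (isBigO_rieszSeries_zero hD (by linarith)) (by simpa using hc0)
    · simpa only [Complex.VerticalIntegrable, hline] using hGc
    · exact (continuousOn_rieszSeries hD (by linarith)).continuousAt (Ioi_mem_nhds hx0)
  have hshift : ∫ y : ℝ, (x : ℂ) ^ (-((c : ℂ) + y * Complex.I)) * G (c + y * Complex.I) =
      ∫ y : ℝ, (x : ℂ) ^ (-((c' : ℂ) + y * Complex.I)) * G (c' + y * Complex.I) := by
    -- For `x ≥ 1` and `re s ≥ c > 0` the factor `x ^ (-s)` has norm at most 1, so the bound `K` for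
    -- `G` still applies.
    refine Complex.integral_vertical_eq (F := fun s => (x : ℂ) ^ (-s) * G s) (C := K) hc1 ?_ ?_
    · refine DifferentiableOn.mul (Differentiable.differentiableOn ?_) hGd
      exact fun s => (differentiableAt_id.neg).const_cpow (Or.inl hxC)
    · intro s h1 h2 h3
      refine le_trans ?_ (hK s h1 h2 h3)
      rw [norm_mul, Complex.norm_cpow_eq_rpow_re_of_pos hx0]
      gcongr
      refine mul_le_of_le_one_left (norm_nonneg _) ?_
      exact Real.rpow_le_one_of_one_le_of_nonpos hx (by rw [Complex.neg_re]; linarith)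
  rw [← hinv, mellinInv]
  simp only [hline, smul_eq_mul]
  rw [hshift, norm_smul, Real.norm_of_nonneg (by positivity), mul_assoc]
  gcongr
  refine (MeasureTheory.norm_integral_le_integral_norm _).trans (le_of_eq ?_)
  rw [← MeasureTheory.integral_mul_const]
  congr 1
  ext y
  rw [norm_mul, Complex.norm_cpow_eq_rpow_re_of_pos hx0, mul_comm]
  simp

end RieszCriterion

theorem mainTheorem6 {ω : ℤ} (hω : 0 < ω) (f : CuspForm 𝒮ℒ ω) (hf : IsHeckeEigenform f)
    (k ℓ : ℝ) (hk : ((ω : ℝ) + 1) / 2 ≤ k) (hℓ : 0 < ℓ) :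
    (∀ x : ℝ, 0 < x → Summable fun n : ℕ =>
      normalizedCoeffInv f n / (((n : ℝ) ^ k : ℝ) : ℂ) * ((Real.exp (-x / (n : ℝ) ^ ℓ) : ℝ) : ℂ)) ∧
    (HeckeRiemannHypothesis hω f ↔
      ∀ ε : ℝ, 0 < ε →
        (fun x : ℝ => ∑' n : ℕ, normalizedCoeffInv f n / (((n : ℝ) ^ k : ℝ) : ℂ) *
          ((Real.exp (-x / (n : ℝ) ^ ℓ) : ℝ) : ℂ))
        =O[Filter.atTop] fun x : ℝ => x ^ (-k / ℓ + 1 / (2 * ℓ) + ε)) := by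
  have hω' : (12 : ℝ) ≤ ω := by exact_mod_cast twelve_le_weight_of_cuspForm_ne_zero hf.1
  obtain ⟨D, -, hD⟩ := hf.exists_norm_normalizedCoeffInv_le hω
  refine ⟨fun x hx => summable_rieszSeries hD (by linarith) hx.le, ?_⟩
  rw [hf.heckeRiemannHypothesis_iff hω]
  refine ⟨fun h0 ε hε => ?_, fun hO s hs =>
    hf.heckeLFunction_ne_zero_of_isBigO hω (by linarith) hℓ hO hs⟩
  -- The cap `1 / ℓ` keeps the target line to the right of the initial line `(k - 3) / ℓ`.
  set ε' : ℝ := min ε (1 / ℓ) with hε'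
  have hε'0 : 0 < ε' := lt_min hε (by positivity)
  obtain ⟨C, hC⟩ := hf.exists_norm_rieszSeries_le hω (k := k) (c' := (k - 1 / 2) / ℓ - ε')
    (by linarith) hℓ h0 (by
      have h1 : ε' ≤ 1 / ℓ := min_le_right _ _
      have h2 : (k - 3) / ℓ + 1 / ℓ ≤ (k - 1 / 2) / ℓ := by
        rw [← add_div]
        gcongr
        linarith
      linarith) (by linarith)
  refine .of_bound |C| ?_
  filter_upwards [Filter.eventually_ge_atTop 1] with x hx
  have hx0 : (0 : ℝ) < x := one_pos.trans_le hx
  refine (hC x hx).trans ?_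
  rw [Real.norm_of_nonneg (by positivity)]
  have hexp : -((k - 1 / 2) / ℓ - ε') ≤ -k / ℓ + 1 / (2 * ℓ) + ε := by
    have h1 : ε' ≤ ε := min_le_left _ _
    have h2 : -((k - 1 / 2) / ℓ) = -k / ℓ + 1 / (2 * ℓ) := by field_simp; ring
    linarith
  have := Real.rpow_le_rpow_of_exponent_le hx hexp
  have h3 := le_abs_self C
  gcongr
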